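/- Let $(V^{4n},\mathcal{Q},\langle\cdot,\cdot\rangle)$ be a Hermitian quaternionic vector space: $V$ is a Euclidean space of real dimension $4n$ and $\mathcal{Q}=\mathrm{span}_{\mathbb{R}}(J_1,J_2,J_3)$, where $J_1,J_2,J_3=J_1J_2$ are anticommuting orthogonal complex structures on $V$; fix this basis $(J_1,J_2,J_3)$ of $\mathcal{Q}$. Let $S(\mathcal{Q})=\{aJ_1+bJ_2+cJ_3 : a^2+b^2+c^2=1\}$, and for $I\in S(\mathcal{Q})$ let $I^\perp$ be the set of $K\in S(\mathcal{Q})$ with $KI=-IK$. Let $Sp(n)$ be the group of elements of $SO(V)$ that commute with all $t\,\mathrm{Id}+aJ_1+bJ_2+cJ_3$, $t^2+a^2+b^2+c^2=1$. A subspace $W$ of $V$ is $I$-complex if $IW=W$, and quaternionic if $AW=W$ for all $A\in S(\mathcal{Q})$. Two subspaces $A,B$ are Hermitian orthogonal if $A^{\mathbb{H}}\perp B^{\mathbb{H}}$, where $A^{\mathbb{H}}=A+J_1A+J_2A+J_3A$. A subspace $U\subseteq V$ is $\Sigma$-complex if it is pure (contains no nonzero quaternionic subspace) and is an orthogonal sum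 $U=U_1\oplus\dots\oplus U_s$, $s\ge 0$, of nonzero subspaces such that $U_i$ is a maximal $I_i$-complex subspace of $U$ for some $I_i\in S(\mathcal{Q})$, with $I_i\neq\pm I_j$ for $i\neq j$. Since $I_i$ and $-I_i$ have the same complex subspaces, the sign of $I_i$ is chosen so that the first nonzero coefficient of $I_i$ in the basis $(J_1,J_2,J_3)$ is positive, and the addends are ordered so that the coefficient vectors of $I_1,\dots,I_s$ increase lexicographically. Let $I\in S(\mathcal{Q})$. The $I^\perp$-Kähler angle of a $4$-dimensional $I$-complex subspace $W$ is the angle $\varphi\in[0,\pi/2]$ such that, for every $K\in I^\perp$, the orthogonal projection to $KW$ multiplies the norm of each vector of $W$ by $\cos\varphi$. For a $2m$-dimensional pure $I$-complex subspace $P$, write $P$ as a Hermitian orthogonal sum of $\lfloor m/2\rfloor$ $I$-complex subspaces of dimension $4$ and, if $m$ is odd, one $I$-complex $2$-plane. The $I^\perp$-Kähler multipleangle of $P$ is the vector of the $I^\perp$-Kähler angles of the $4$-dimensional addends in increasing order, followed by the entry $\pi/2$ if $m$ is odd. For a $\Sigma$-complex subspace $U=\bigoplus_i U_i$ with $\dim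 U_i=2m_i$ let $\mathcal{I}=(I_1,\dots,I_s)$ and let $\Theta$ be the vector whose $i$-th entry is the $I_i^\perp$-Kähler multipleangle of $U_i$, considered as the multipleangle of a $2m_i$-dimensional subspace (so that the $i$-th entry includes the number $m_i$). Theorem. Every $\Sigma$-complex subspace $U$ of $V$ has exactly one pair $(\mathcal{I},\Theta)$, and this pair completely determines the $Sp(n)$-orbit of $U$ in the real Grassmannian: two $\Sigma$-complex subspaces $U,W$ of $V$ with pairs $(\mathcal{I},\Theta)$ and $(\mathcal{I}',\Theta')$ satisfy $W=gU$ for some $g\in Sp(n)$ if and only if $(\mathcal{I},\Theta)=(\mathcal{I}',\Theta')$. -/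

import Mathlib

open Module

noncomputable section

/-- A Hermitian hypercomplex structure `(J₁, J₂, J₃)` on a Euclidean space `V`.  Such a triple is an
admissible basis of the Hermitian quaternionic structure `span ℝ {J₁, J₂, J₃}`, and every Hermitian
quaternionic structure is given in this way. -/
structure HermitianHypercomplex (V : Type*) [NormedAddCommGroup V] [InnerProductSpace ℝ V] where
  J₁ : End ℝ V
  J₂ : End ℝ V
  J₃ : End ℝ V
  sq₁ : J₁ * J₁ = -1
  sq₂ : J₂ * J₂ = -1
  sq₃ : J₃ * J₃ = -1
  anti₁₂ : J₂ * J₁ = -(J₁ * J₂)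
  anti₁₃ : J₃ * J₁ = -(J₁ * J₃)
  anti₂₃ : J₃ * J₂ = -(J₂ * J₃)
  mul₁₂ : J₁ * J₂ = J₃
  inner₁ : ∀ x y : V, inner ℝ (J₁ x) (J₁ y) = inner ℝ x y
  inner₂ : ∀ x y : V, inner ℝ (J₂ x) (J₂ y) = inner ℝ x y
  inner₃ : ∀ x y : V, inner ℝ (J₃ x) (J₃ y) = inner ℝ x y

namespace HermitianHypercomplex

variable {V : Type*} [NormedAddCommGroup V] [InnerProductSpace ℝ V]

/-- The element of the quaternionic structure with coefficients `a, b, c` in the admissible basis. -/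
def comb (H : HermitianHypercomplex V) (a b c : ℝ) : End ℝ V :=
  a • H.J₁ + b • H.J₂ + c • H.J₃

/-- The 2-sphere of complex structures in the quaternionic structure. -/
def sphere (H : HermitianHypercomplex V) : Set (End ℝ V) :=
  {A | ∃ a b c : ℝ, a ^ 2 + b ^ 2 + c ^ 2 = 1 ∧ A = H.comb a b c}

/-- `I^⊥`: the complex structures of the sphere that anticommute with `I`.  If `(I, J, K)` is an
admissible basis, these are the `β J + γ K` with `β² + γ² = 1`. -/
def perp (H : HermitianHypercomplex V) (I : End ℝ V) : Set (End ℝ V) :=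
  {K | K ∈ H.sphere ∧ K * I = -(I * K)}

/-- The homotheties of `V` by unit quaternions: the image of `Sp(1)` in the endomorphisms. -/
def unitHomotheties (H : HermitianHypercomplex V) : Set (End ℝ V) :=
  {R | ∃ t a b c : ℝ, t ^ 2 + a ^ 2 + b ^ 2 + c ^ 2 = 1 ∧ R = t • (1 : End ℝ V) + H.comb a b c}

/-- The group `Sp(n)`: the isometries of determinant one that commute with all homotheties by unit
quaternions. -/
def Sp (H : HermitianHypercomplex V) : Subgroup (V ≃ₗᵢ[ℝ] V) where
  carrier := {g | LinearMap.det (g.toLinearEquiv : V →ₗ[ℝ] V) = 1 ∧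
    ∀ R ∈ H.unitHomotheties, ∀ x : V, g (R x) = R (g x)}
  mul_mem' := by
    rintro g h ⟨hg, hg'⟩ ⟨hh, hh'⟩
    refine ⟨?_, fun R hR x => ?_⟩
    · have : ((g * h).toLinearEquiv : V →ₗ[ℝ] V)
          = (g.toLinearEquiv : V →ₗ[ℝ] V) ∘ₗ (h.toLinearEquiv : V →ₗ[ℝ] V) := rfl
      rw [this, LinearMap.det_comp, hg, hh, one_mul]
    · change g (h (R x)) = R (g (h x))
      rw [hh' R hR, hg' R hR]
  one_mem' := by
    refine ⟨?_, fun R _ x => rfl⟩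
    have : ((1 : V ≃ₗᵢ[ℝ] V).toLinearEquiv : V →ₗ[ℝ] V) = LinearMap.id := rfl
    rw [this, LinearMap.det_id]
  inv_mem' := by
    rintro g ⟨hg, hg'⟩
    refine ⟨?_, fun R hR x => ?_⟩
    · have h : (g⁻¹.toLinearEquiv : V →ₗ[ℝ] V) ∘ₗ (g.toLinearEquiv : V →ₗ[ℝ] V)
          = LinearMap.id := by
        ext x
        exact g.symm_apply_apply x
      have h2 := congrArg LinearMap.det h
      rwa [LinearMap.det_comp, hg, mul_one, LinearMap.det_id] at h2
    · change g.symm (R x) = R (g.symm x)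
      apply g.injective
      rw [hg' R hR, g.apply_symm_apply, g.apply_symm_apply]

/-- The `Sp(n)`-orbit of a subspace in the Grassmannian of real subspaces of `V`. -/
def orbit (H : HermitianHypercomplex V) (U : Submodule ℝ V) : Set (Submodule ℝ V) :=
  {W | ∃ g ∈ H.Sp, U.map (g.toLinearEquiv : V →ₗ[ℝ] V) = W}

/-- `U` is `A`-complex: `A U = U`. -/
def IsComplex (A : End ℝ V) (U : Submodule ℝ V) : Prop :=
  U.map A = U

/-- `U` is quaternionic: `A U = U` for every `A` in the sphere. -/
def IsQuaternionic (H : HermitianHypercomplex V) (U : Submodule ℝ V) : Prop :=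
  ∀ A ∈ H.sphere, U.map A = U

/-- `U` is pure: it contains no nonzero quaternionic subspace. -/
def IsPure (H : HermitianHypercomplex V) (U : Submodule ℝ V) : Prop :=
  ∀ W : Submodule ℝ V, W ≤ U → H.IsQuaternionic W → W = ⊥

/-- The quaternionification of `U`: the subspace spanned by `U` over the quaternions. -/
def quaternionification (H : HermitianHypercomplex V) (U : Submodule ℝ V) : Submodule ℝ V :=
  U ⊔ U.map H.J₁ ⊔ U.map H.J₂ ⊔ U.map H.J₃

/-- Orthogonality in the Hermitian sense: the quaternionifications are orthogonal. -/
def HermitianOrtho (H : HermitianHypercomplex V) (A B : Submodule ℝ V) : Prop :=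
  H.quaternionification A ⟂ H.quaternionification B

/-- `U` is the orthogonal sum of the nonzero subspaces `P i`, where `P i` is a maximal
`I i`-complex subspace of `U` and the structures `I i` are pairwise distinct up to sign. -/
structure IsSigmaDecomposition (H : HermitianHypercomplex V) (U : Submodule ℝ V) {s : ℕ}
    (I : Fin s → End ℝ V) (P : Fin s → Submodule ℝ V) : Prop where
  mem_sphere : ∀ i, I i ∈ H.sphere
  distinct : ∀ i j, i ≠ j → I i ≠ I j ∧ I i ≠ -I j
  ne_bot : ∀ i, P i ≠ ⊥
  maximal : ∀ i, Maximal (fun W : Submodule ℝ V => W ≤ U ∧ IsComplex (I i) W) (P i)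
  ortho : ∀ i j, i ≠ j → P i ⟂ P j
  iSup_eq : ⨆ i, P i = U

/-- `U` is `Σ`-complex: it is pure and an orthogonal sum of maximal complex subspaces. -/
def IsSigmaComplex (H : HermitianHypercomplex V) (U : Submodule ℝ V) : Prop :=
  H.IsPure U ∧ ∃ (s : ℕ) (I : Fin s → End ℝ V) (P : Fin s → Submodule ℝ V),
    H.IsSigmaDecomposition U I P

/-- The lexicographic order of the coefficients in the admissible basis. -/
def LexLT (H : HermitianHypercomplex V) (A B : End ℝ V) : Prop :=
  ∃ a b c a' b' c' : ℝ, A = H.comb a b c ∧ B = H.comb a' b' c' ∧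
    (a < a' ∨ (a = a' ∧ (b < b' ∨ (b = b' ∧ c < c'))))

variable [FiniteDimensional ℝ V]

/-- Two subspaces of the same dimension are isoclinic with angle of isoclinicity `φ ∈ [0, π/2]`:
every nonzero vector of `A` makes the angle `φ` with its orthogonal projection to `B`. -/
def IsIsoclinic (A B : Submodule ℝ V) (φ : ℝ) : Prop :=
  finrank ℝ A = finrank ℝ B ∧ 0 ≤ φ ∧ φ ≤ Real.pi / 2 ∧
    ∀ x ∈ A, ‖B.starProjection x‖ = Real.cos φ * ‖x‖

/-- `φ` is the `I^⊥`-Kähler angle of the (4-dimensional, `I`-complex) subspace `W`: the angle of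
isoclinicity of the pair `(W, K W)` for `K ∈ I^⊥`. -/
def IsKahlerAngle (H : HermitianHypercomplex V) (I : End ℝ V) (W : Submodule ℝ V) (φ : ℝ) : Prop :=
  ∀ K ∈ H.perp I, IsIsoclinic W (W.map K) φ

/-- `θ` is the `I^⊥`-Kähler multipleangle of the `I`-complex subspace `U` of dimension `2 * m`:
`U` is the Hermitian orthogonal sum of 4-dimensional `I`-complex subspaces, and of an `I`-complex
2-plane if `m` is odd; the list `θ` consists of the `I^⊥`-Kähler angles of the 4-dimensional addends
in increasing order, followed by `π/2` if `m` is odd. -/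
def IsKahlerMultipleangle (H : HermitianHypercomplex V) (I : End ℝ V) (U : Submodule ℝ V) (m : ℕ)
    (θ : List ℝ) : Prop :=
  finrank ℝ U = 2 * m ∧
  ∃ (k : ℕ) (B : Fin k → Submodule ℝ V) (φ : Fin k → ℝ),
    (∀ j, finrank ℝ (B j) = 4 ∧ IsComplex I (B j) ∧ H.IsKahlerAngle I (B j) (φ j)) ∧
    (∀ j l, j ≠ l → H.HermitianOrtho (B j) (B l)) ∧
    Monotone φ ∧
    ((m = 2 * k ∧ ⨆ j, B j = U ∧ θ = List.ofFn φ) ∨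
      (m = 2 * k + 1 ∧ ∃ C : Submodule ℝ V, finrank ℝ C = 2 ∧ IsComplex I C ∧
        (∀ j, H.HermitianOrtho (B j) C) ∧ (⨆ j, B j) ⊔ C = U ∧
        θ = List.ofFn φ ++ [Real.pi / 2]))

/-- `(𝓘, Θ)` is the pair attached to the `Σ`-complex subspace `U`, for the fixed admissible basis.
`𝓘` lists the structures of the complex addends: of `I` and `-I`, which have the same complex
subspaces, the one with lexicographically positive coefficients is taken, and the structures stand
in increasing lexicographic order.  `Θ` lists, in the same order, the Kähler multipleangles of the
addends, each together with the number `m i` for which the addend has dimension `2 * m i`. -/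
def HasInvariants (H : HermitianHypercomplex V) (U : Submodule ℝ V)
    (𝓘 : List (End ℝ V)) (Θ : List (ℕ × List ℝ)) : Prop :=
  ∃ (s : ℕ) (I : Fin s → End ℝ V) (P : Fin s → Submodule ℝ V) (m : Fin s → ℕ)
    (θ : Fin s → List ℝ),
    H.IsSigmaDecomposition U I P ∧
    (∀ i, H.LexLT 0 (I i)) ∧
    (∀ i j, i < j → H.LexLT (I i) (I j)) ∧
    (∀ i, H.IsKahlerMultipleangle (I i) (P i) (m i) (θ i)) ∧
    𝓘 = List.ofFn I ∧ Θ = List.ofFn (fun i => (m i, θ i))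

end HermitianHypercomplex

end

/-! Two principles carry the proof. The first is a quaternionic Witt theorem,
`exists_mem_Sp_of_sameGram`: two families with equal quaternionic Gram matrices are related by an
element of Sp(n). Hence isometries of Hermitian orthogonal addends glue (`exists_mem_Sp_map_eq`),
and it suffices to move each addend separately.

The second is the compression A of J₂ to a J₁-complex subspace P (`kahlerMap`). It is skew and
anticommutes with J₁, so A² is symmetric with eigenvalues -c². An eigenvector x and the direction of
Ax generate a 4-dimensional block on which A is c times an isometry, so that c = cos φ; splitting
off blocks gives the multipleangle. The quaternionic Gram matrix of a block depends on φ only,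
whence conjugacy, and the multiplicities of the eigenvalues of A² depend on P only, whence
uniqueness (`angles_unique`). Any I in the sphere can play the role of J₁ by `exists_rebase`.

For Σ-complex U, orthogonal addends of different structures are automatically Hermitian orthogonal
(`hermitianOrtho_of_isComplex`). By purity, any complex subspace of U has, up to sign, the structure
of some addend (`eq_or_eq_neg_of_isComplex`). So the structures are determined by U, the addends by
maximality, and the sign and order conventions make the pair unique. -/

namespace HermitianHypercomplex

/-! ### Quaternion relations, the sphere of structures, and change of admissible basis. -/

section Basic

variable {V : Type*} [NormedAddCommGroup V] [InnerProductSpace ℝ V]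
  (H : HermitianHypercomplex V)

@[simp] lemma J₁_J₁ (x : V) : H.J₁ (H.J₁ x) = -x := by
  simpa using LinearMap.congr_fun H.sq₁ x

@[simp] lemma J₂_J₂ (x : V) : H.J₂ (H.J₂ x) = -x := by
  simpa using LinearMap.congr_fun H.sq₂ x

@[simp] lemma J₃_J₃ (x : V) : H.J₃ (H.J₃ x) = -x := by
  simpa using LinearMap.congr_fun H.sq₃ x

@[simp] lemma J₁_J₂ (x : V) : H.J₁ (H.J₂ x) = H.J₃ x :=
  LinearMap.congr_fun H.mul₁₂ x

@[simp] lemma J₂_J₁ (x : V) : H.J₂ (H.J₁ x) = -H.J₃ x := by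
  simpa using LinearMap.congr_fun H.anti₁₂ x

@[simp] lemma J₁_J₃ (x : V) : H.J₁ (H.J₃ x) = -H.J₂ x := by
  rw [← J₁_J₂, J₁_J₁]

@[simp] lemma J₃_J₁ (x : V) : H.J₃ (H.J₁ x) = H.J₂ x := by
  rw [← J₁_J₂, J₂_J₁, map_neg, J₁_J₃, neg_neg]

@[simp] lemma J₃_J₂ (x : V) : H.J₃ (H.J₂ x) = -H.J₁ x := by
  rw [← J₁_J₂, J₂_J₂, map_neg]

@[simp] lemma J₂_J₃ (x : V) : H.J₂ (H.J₃ x) = H.J₁ x := by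
  rw [← J₁_J₂, J₂_J₁, J₃_J₂, neg_neg]

lemma inner_J₁_left (x y : V) : inner ℝ (H.J₁ x) y = -inner ℝ x (H.J₁ y) := by
  rw [← H.inner₁ x]; simp

lemma inner_J₂_left (x y : V) : inner ℝ (H.J₂ x) y = -inner ℝ x (H.J₂ y) := by
  rw [← H.inner₂ x]; simp

lemma inner_J₃_left (x y : V) : inner ℝ (H.J₃ x) y = -inner ℝ x (H.J₃ y) := by
  rw [← H.inner₃ x]; simp

lemma inner_J₁_self (x : V) : inner ℝ x (H.J₁ x) = 0 := by
  have := H.inner_J₁_left x x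
  rw [real_inner_comm] at this; linarith

lemma inner_J₂_self (x : V) : inner ℝ x (H.J₂ x) = 0 := by
  have := H.inner_J₂_left x x
  rw [real_inner_comm] at this; linarith

lemma inner_J₃_self (x : V) : inner ℝ x (H.J₃ x) = 0 := by
  have := H.inner_J₃_left x x
  rw [real_inner_comm] at this; linarith

lemma comb_apply (a b c : ℝ) (x : V) :
    H.comb a b c x = a • H.J₁ x + b • H.J₂ x + c • H.J₃ x := by
  simp [comb]

lemma J₁_eq_comb : H.J₁ = H.comb 1 0 0 := by simp [comb]

lemma J₂_eq_comb : H.J₂ = H.comb 0 1 0 := by simp [comb]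

lemma J₃_eq_comb : H.J₃ = H.comb 0 0 1 := by simp [comb]

lemma J₁_mem_sphere : H.J₁ ∈ H.sphere := ⟨1, 0, 0, by norm_num, H.J₁_eq_comb⟩

lemma J₂_mem_sphere : H.J₂ ∈ H.sphere := ⟨0, 1, 0, by norm_num, H.J₂_eq_comb⟩

lemma J₃_mem_sphere : H.J₃ ∈ H.sphere := ⟨0, 0, 1, by norm_num, H.J₃_eq_comb⟩

lemma neg_mem_sphere {A : End ℝ V} (hA : A ∈ H.sphere) : -A ∈ H.sphere := by
  obtain ⟨a, b, c, h, rfl⟩ := hA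
  exact ⟨-a, -b, -c, by linarith, by simp only [comb]; module⟩

lemma comb_mul_comb_apply (a b c d e f : ℝ) (x : V) :
    H.comb a b c (H.comb d e f x) = -(a * d + b * e + c * f) • x +
      H.comb (b * f - c * e) (c * d - a * f) (a * e - b * d) x := by
  simp only [comb_apply, map_add, map_smul, J₁_J₁, J₁_J₂, J₁_J₃, J₂_J₁, J₂_J₂, J₂_J₃, J₃_J₁,
    J₃_J₂, J₃_J₃]
  module

variable {H}

lemma sphere_sq {A : End ℝ V} (hA : A ∈ H.sphere) (x : V) : A (A x) = -x := by
  obtain ⟨a, b, c, h, rfl⟩ := hA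
  rw [comb_mul_comb_apply, show a * a + b * b + c * c = 1 by linarith, comb_apply]
  module

lemma inner_sphere_left {A : End ℝ V} (hA : A ∈ H.sphere) (x y : V) :
    inner ℝ (A x) y = -inner ℝ x (A y) := by
  obtain ⟨a, b, c, h, rfl⟩ := hA
  simp only [comb_apply, inner_add_left, inner_add_right, inner_smul_left, inner_smul_right,
    inner_J₁_left, inner_J₂_left, inner_J₃_left, RCLike.conj_to_real]
  ring

lemma inner_sphere {A : End ℝ V} (hA : A ∈ H.sphere) (x y : V) :
    inner ℝ (A x) (A y) = inner ℝ x y := by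
  rw [inner_sphere_left hA, sphere_sq hA, inner_neg_right, neg_neg]

lemma norm_sphere {A : End ℝ V} (hA : A ∈ H.sphere) (x : V) : ‖A x‖ = ‖x‖ := by
  rw [@norm_eq_sqrt_real_inner V, @norm_eq_sqrt_real_inner V, inner_sphere hA]

lemma isComplex_iff {A : End ℝ V} (hA : A ∈ H.sphere) {U : Submodule ℝ V} :
    IsComplex A U ↔ ∀ x ∈ U, A x ∈ U := by
  constructor
  · intro h x hx
    rw [← h]; exact Submodule.mem_map_of_mem hx
  · intro h
    apply le_antisymm
    · rw [Submodule.map_le_iff_le_comap]; exact h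
    · intro x hx
      exact ⟨-A x, U.neg_mem (h x hx), by rw [map_neg, sphere_sq hA, neg_neg]⟩

lemma inner_comb_right (x y : V) (a b c : ℝ) : inner ℝ x (H.comb a b c y) =
    a * inner ℝ x (H.J₁ y) + b * inner ℝ x (H.J₂ y) + c * inner ℝ x (H.J₃ y) := by
  simp only [comb_apply, inner_add_right, inner_smul_right]

/-- Hermitian orthogonality in terms of the inner products with the structures of the basis. -/
lemma hermitianOrtho_iff {A B : Submodule ℝ V} : H.HermitianOrtho A B ↔
    ∀ a ∈ A, ∀ b ∈ B, inner ℝ a b = 0 ∧ inner ℝ a (H.J₁ b) = 0 ∧ inner ℝ a (H.J₂ b) = 0 ∧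
      inner ℝ a (H.J₃ b) = 0 := by
  constructor
  · intro h a ha b hb
    rw [HermitianOrtho, Submodule.isOrtho_iff_inner_eq] at h
    have hA : A ≤ H.quaternionification A :=
      (le_sup_left.trans le_sup_left).trans le_sup_left
    exact ⟨h a (hA ha) b (Submodule.mem_sup_left (Submodule.mem_sup_left
        (Submodule.mem_sup_left hb))),
      h a (hA ha) _ (Submodule.mem_sup_left (Submodule.mem_sup_left
        (Submodule.mem_sup_right (Submodule.mem_map_of_mem hb)))),
      h a (hA ha) _ (Submodule.mem_sup_left (Submodule.mem_sup_right
        (Submodule.mem_map_of_mem hb))),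
      h a (hA ha) _ (Submodule.mem_sup_right (Submodule.mem_map_of_mem hb))⟩
  · intro h
    simp only [HermitianOrtho, quaternionification, Submodule.isOrtho_sup_left,
      Submodule.isOrtho_sup_right]
    simp only [Submodule.isOrtho_iff_inner_eq, Submodule.mem_map,
      forall_exists_index, and_imp, forall_apply_eq_imp_iff₂, inner_J₁_left, inner_J₂_left,
      inner_J₃_left, J₁_J₁, J₁_J₂, J₁_J₃, J₂_J₁, J₂_J₂, J₂_J₃, J₃_J₁, J₃_J₂, J₃_J₃,
      inner_neg_right, neg_neg, neg_eq_zero]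
    have h0 := fun a ha b hb => (h a ha b hb).1
    have h1 := fun a ha b hb => (h a ha b hb).2.1
    have h2 := fun a ha b hb => (h a ha b hb).2.2.1
    have h3 := fun a ha b hb => (h a ha b hb).2.2.2
    tauto

/-- Two orthonormal rows and their cross product form an orthogonal 3×3 matrix, so its columns are
orthonormal too. This gives the norm of a column, and `inner_col` the product of two columns; cyclic
shifts give the others. -/
lemma norm_col_sq {a b c d e f : ℝ} (h1 : a ^ 2 + b ^ 2 + c ^ 2 = 1)
    (h2 : d ^ 2 + e ^ 2 + f ^ 2 = 1) (h3 : a * d + b * e + c * f = 0) :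
    a ^ 2 + d ^ 2 + (b * f - c * e) ^ 2 = 1 := by
  have : b * e + c * f = - (a * d) := by linarith
  have h4 : (b * e + c * f) ^ 2 = (a * d) ^ 2 := by rw [this]; ring
  linear_combination (e ^ 2 + f ^ 2) * h1 + (1 - a ^ 2) * h2 - h4

lemma inner_col {a b c d e f : ℝ} (h1 : a ^ 2 + b ^ 2 + c ^ 2 = 1)
    (h2 : d ^ 2 + e ^ 2 + f ^ 2 = 1) (h3 : a * d + b * e + c * f = 0) :
    a * b + d * e + (b * f - c * e) * (c * d - a * f) = 0 := by
  linear_combination (b * d + a * e) * h3 - a * b * h2 - d * e * h1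

lemma exists_unit_orthogonal (a b c : ℝ) : ∃ d e f : ℝ, d ^ 2 + e ^ 2 + f ^ 2 = 1 ∧
    a * d + b * e + c * f = 0 := by
  by_cases h : a ^ 2 + b ^ 2 = 0
  · have ha : a = 0 := by nlinarith [sq_nonneg a, sq_nonneg b]
    have hb : b = 0 := by nlinarith [sq_nonneg a, sq_nonneg b]
    exact ⟨1, 0, 0, by norm_num, by simp [ha]⟩
  · have hp : 0 < a ^ 2 + b ^ 2 := lt_of_le_of_ne (by positivity) (Ne.symm h)
    refine ⟨-b / √(a ^ 2 + b ^ 2), a / √(a ^ 2 + b ^ 2), 0, ?_, by ring⟩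
    rw [div_pow, div_pow, Real.sq_sqrt hp.le]
    field_simp
    ring

/-- Any structure of the sphere is the first one of an admissible basis with the same sphere. -/
lemma exists_rebase {I : End ℝ V} (hI : I ∈ H.sphere) :
    ∃ H' : HermitianHypercomplex V, H'.J₁ = I ∧ H'.sphere = H.sphere := by
  obtain ⟨a, b, c, h1, rfl⟩ := hI
  obtain ⟨d, e, f, h2, h3⟩ := exists_unit_orthogonal a b c
  have hk : (b * f - c * e) ^ 2 + (c * d - a * f) ^ 2 + (a * e - b * d) ^ 2 = 1 := by
    linear_combination h1 * (d ^ 2 + e ^ 2 + f ^ 2) + h2 - (a * d + b * e + c * f) * h3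
  have hI : H.comb a b c ∈ H.sphere := ⟨a, b, c, h1, rfl⟩
  have hK : H.comb d e f ∈ H.sphere := ⟨d, e, f, h2, rfl⟩
  have hL : H.comb (b * f - c * e) (c * d - a * f) (a * e - b * d) ∈ H.sphere :=
    ⟨_, _, _, hk, rfl⟩
  have e12 (x : V) : H.comb a b c (H.comb d e f x) =
      H.comb (b * f - c * e) (c * d - a * f) (a * e - b * d) x := by
    rw [comb_mul_comb_apply, h3]; simp
  have e21 (x : V) : H.comb d e f (H.comb a b c x) =
      -H.comb (b * f - c * e) (c * d - a * f) (a * e - b * d) x := by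
    rw [comb_mul_comb_apply, show d * a + e * b + f * c = 0 by linarith]
    simp only [comb_apply]; module
  let H' : HermitianHypercomplex V :=
    { J₁ := H.comb a b c
      J₂ := H.comb d e f
      J₃ := H.comb (b * f - c * e) (c * d - a * f) (a * e - b * d)
      sq₁ := by ext x; simp [sphere_sq hI]
      sq₂ := by ext x; simp [sphere_sq hK]
      sq₃ := by ext x; simp [sphere_sq hL]
      anti₁₂ := by ext x; simp [e12, e21]
      anti₁₃ := by
        ext x
        simp only [Module.End.mul_apply, LinearMap.neg_apply]
        rw [← e12, ← e12, e21, map_neg, ← e12]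
      anti₂₃ := by
        ext x
        simp only [Module.End.mul_apply, LinearMap.neg_apply]
        rw [← e12, ← e12, e21, ← e12, neg_neg]
      mul₁₂ := by ext x; simp [e12]
      inner₁ := inner_sphere hI
      inner₂ := inner_sphere hK
      inner₃ := inner_sphere hL }
  -- The coefficients change by an orthogonal matrix, so the unit sphere is preserved.
  have hc (p q r : ℝ) : H'.comb p q r = H.comb (p * a + q * d + r * (b * f - c * e))
      (p * b + q * e + r * (c * d - a * f)) (p * c + q * f + r * (a * e - b * d)) := by
    simp only [comb, H']; module
  have n1 := norm_col_sq h1 h2 h3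
  have n2 := @norm_col_sq b c a e f d (by linarith) (by linarith) (by linarith)
  have n3 := @norm_col_sq c a b f d e (by linarith) (by linarith) (by linarith)
  have i1 := inner_col h1 h2 h3
  have i2 := @inner_col b c a e f d (by linarith) (by linarith) (by linarith)
  have i3 := @inner_col c a b f d e (by linarith) (by linarith) (by linarith)
  refine ⟨H', rfl, Set.ext fun A => ⟨?_, ?_⟩⟩
  · rintro ⟨p, q, r, hp, rfl⟩
    refine ⟨_, _, _, ?_, hc p q r⟩
    linear_combination p ^ 2 * h1 + q ^ 2 * h2 + r ^ 2 * hk + hp + 2 * p * q * h3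
  · rintro ⟨u, v, w, hu, rfl⟩
    -- The inverse change of coefficients is the transposed matrix.
    refine ⟨u * a + v * b + w * c, u * d + v * e + w * f,
      u * (b * f - c * e) + v * (c * d - a * f) + w * (a * e - b * d), ?_, ?_⟩
    · linear_combination u ^ 2 * n1 + v ^ 2 * n2 + w ^ 2 * n3 + hu + 2 * u * v * i1 +
        2 * v * w * i2 + 2 * u * w * i3
    · rw [hc]
      congr 1
      · linear_combination -u * n1 - v * i1 - w * i3
      · linear_combination -u * i1 - v * n2 - w * i2
      · linear_combination -u * i3 - v * i2 - w * n3

end Basic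
end HermitianHypercomplex

namespace HermitianHypercomplex

/-! ### Notions that depend only on the sphere, not on the admissible basis. -/

section Congruence

variable {V : Type*} [NormedAddCommGroup V] [InnerProductSpace ℝ V]
  {H H' : HermitianHypercomplex V}

lemma map_le_quaternionification {A : End ℝ V} (hA : A ∈ H.sphere) (U : Submodule ℝ V) :
    U.map A ≤ H.quaternionification U := by
  obtain ⟨a, b, c, -, rfl⟩ := hA
  rintro _ ⟨x, hx, rfl⟩
  rw [comb_apply]
  refine add_mem (add_mem ?_ ?_) ?_ <;> apply Submodule.smul_mem
  · exact Submodule.mem_sup_left (Submodule.mem_sup_left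
      (Submodule.mem_sup_right (Submodule.mem_map_of_mem hx)))
  · exact Submodule.mem_sup_left (Submodule.mem_sup_right (Submodule.mem_map_of_mem hx))
  · exact Submodule.mem_sup_right (Submodule.mem_map_of_mem hx)

lemma quaternionification_congr (h : H.sphere = H'.sphere) (U : Submodule ℝ V) :
    H.quaternionification U = H'.quaternionification U := by
  apply le_antisymm
  · refine sup_le (sup_le (sup_le ((le_sup_left.trans le_sup_left).trans le_sup_left) ?_) ?_) ?_
    exacts [map_le_quaternionification (h ▸ H.J₁_mem_sphere) U,
      map_le_quaternionification (h ▸ H.J₂_mem_sphere) U,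
      map_le_quaternionification (h ▸ H.J₃_mem_sphere) U]
  · refine sup_le (sup_le (sup_le ((le_sup_left.trans le_sup_left).trans le_sup_left) ?_) ?_) ?_
    exacts [map_le_quaternionification (h ▸ H'.J₁_mem_sphere) U,
      map_le_quaternionification (h ▸ H'.J₂_mem_sphere) U,
      map_le_quaternionification (h ▸ H'.J₃_mem_sphere) U]

lemma hermitianOrtho_congr (h : H.sphere = H'.sphere) {A B : Submodule ℝ V} :
    H.HermitianOrtho A B ↔ H'.HermitianOrtho A B := by
  simp only [HermitianOrtho, quaternionification_congr h]

lemma perp_congr (h : H.sphere = H'.sphere) (I : End ℝ V) : H.perp I = H'.perp I := by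
  simp only [perp, h]

lemma HermitianOrtho.symm {A B : Submodule ℝ V} (h : H.HermitianOrtho A B) :
    H.HermitianOrtho B A :=
  Submodule.IsOrtho.symm h

lemma mem_Sp_iff {g : V ≃ₗᵢ[ℝ] V} : g ∈ H.Sp ↔
    LinearMap.det (g.toLinearEquiv : V →ₗ[ℝ] V) = 1 ∧
      ∀ A ∈ H.sphere, ∀ x, g (A x) = A (g x) := by
  constructor
  · rintro ⟨h1, h2⟩
    refine ⟨h1, ?_⟩
    rintro A ⟨a, b, c, h, rfl⟩ x
    simpa using h2 (H.comb a b c) ⟨0, a, b, c, by linarith, by simp⟩ x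
  · rintro ⟨h1, h2⟩
    refine ⟨h1, ?_⟩
    rintro R ⟨t, a, b, c, -, rfl⟩ x
    have e1 := h2 _ H.J₁_mem_sphere x
    have e2 := h2 _ H.J₂_mem_sphere x
    have e3 := h2 _ H.J₃_mem_sphere x
    simp [comb_apply, e1, e2, e3]

lemma Sp_congr (h : H.sphere = H'.sphere) : H.Sp = H'.Sp := by
  ext g; rw [mem_Sp_iff, mem_Sp_iff, h]

lemma isKahlerMultipleangle_congr [FiniteDimensional ℝ V] (h : H.sphere = H'.sphere)
    {I : End ℝ V} {U : Submodule ℝ V} {m : ℕ} {θ : List ℝ} :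
    H.IsKahlerMultipleangle I U m θ ↔ H'.IsKahlerMultipleangle I U m θ := by
  simp only [IsKahlerMultipleangle, IsKahlerAngle, perp_congr h, hermitianOrtho_congr h]

end Congruence

/-! ### Quaternionic Gram data of pairs of vectors. -/

section Gram

variable {V : Type*} [NormedAddCommGroup V] [InnerProductSpace ℝ V]
  (H : HermitianHypercomplex V)

/-- Pairs of vectors with the same inner products with all quaternionic multiples. -/
def SameGram (p q : V × V) : Prop :=
  inner ℝ p.1 q.1 = inner ℝ p.2 q.2 ∧
  inner ℝ p.1 (H.J₁ q.1) = inner ℝ p.2 (H.J₁ q.2) ∧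
  inner ℝ p.1 (H.J₂ q.1) = inner ℝ p.2 (H.J₂ q.2) ∧
  inner ℝ p.1 (H.J₃ q.1) = inner ℝ p.2 (H.J₃ q.2)

variable {H}

lemma SameGram.symm {p q : V × V} (h : H.SameGram p q) : H.SameGram q p := by
  obtain ⟨h0, h1, h2, h3⟩ := h
  refine ⟨?_, ?_, ?_, ?_⟩
  · rw [real_inner_comm, h0, real_inner_comm]
  · rw [real_inner_comm, inner_J₁_left, h1, ← inner_J₁_left, real_inner_comm]
  · rw [real_inner_comm, inner_J₂_left, h2, ← inner_J₂_left, real_inner_comm]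
  · rw [real_inner_comm, inner_J₃_left, h3, ← inner_J₃_left, real_inner_comm]

lemma sameGram_self_iff {p : V × V} : H.SameGram p p ↔ ‖p.1‖ = ‖p.2‖ := by
  simp [SameGram, inner_J₁_self, inner_J₂_self, inner_J₃_self]

lemma SameGram.add_left {p p' q : V × V} (h : H.SameGram p q) (h' : H.SameGram p' q) :
    H.SameGram (p + p') q := by
  obtain ⟨h0, h1, h2, h3⟩ := h
  obtain ⟨h0', h1', h2', h3'⟩ := h'
  simp [SameGram, inner_add_left, *]

lemma SameGram.smul_left {p q : V × V} (r : ℝ) (h : H.SameGram p q) :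
    H.SameGram (r • p) q := by
  obtain ⟨h0, h1, h2, h3⟩ := h
  simp [SameGram, inner_smul_left, *]

lemma SameGram.J₁_left {p q : V × V} (h : H.SameGram p q) :
    H.SameGram (H.J₁ p.1, H.J₁ p.2) q := by
  obtain ⟨h0, h1, h2, h3⟩ := h
  simp [SameGram, inner_J₁_left, *]

lemma SameGram.J₂_left {p q : V × V} (h : H.SameGram p q) :
    H.SameGram (H.J₂ p.1, H.J₂ p.2) q := by
  obtain ⟨h0, h1, h2, h3⟩ := h
  simp [SameGram, inner_J₂_left, *]

end Gram

/-! ### Witt's theorem for Sp(n). -/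

section Isometries

variable {V : Type*} [NormedAddCommGroup V] [InnerProductSpace ℝ V] [FiniteDimensional ℝ V]
  (H : HermitianHypercomplex V)

include H in
/-- A real endomorphism commuting with a complex structure has nonnegative determinant. -/
lemma det_nonneg_of_commute (g : V →ₗ[ℝ] V) (hg : ∀ x, g (H.J₁ x) = H.J₁ (g x)) :
    0 ≤ LinearMap.det g := by
  -- With i acting as J₁, the map is complex linear, and its real determinant is the squared modulus
  -- of the complex one.
  let ρ : ℂ →ₐ[ℝ] End ℝ V := Complex.lift ⟨H.J₁, H.sq₁⟩
  let : Module ℂ V := Module.compHom V ρ.toRingHom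
  have hsmul (z : ℂ) (x : V) : z • x = z.re • x + z.im • H.J₁ x := by
    change ρ z x = _
    simp [ρ, Complex.liftAux_apply, Algebra.algebraMap_eq_smul_one]
  have : IsScalarTower ℝ ℂ V := ⟨fun r z x => by simp [hsmul, smul_smul]⟩
  let f : V →ₗ[ℂ] V :=
    { toFun := g
      map_add' := map_add g
      map_smul' := fun z x => by simp [hsmul, hg] }
  have : FiniteDimensional ℂ V := FiniteDimensional.right ℝ ℂ V
  have : g = f.restrictScalars ℝ := rfl
  rw [this, LinearMap.det_restrictScalars, Algebra.norm_complex_apply]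
  exact Complex.normSq_nonneg _

/-- An isometry has determinant ±1, and commuting with J₁ excludes -1; J₃ = J₁J₂ takes care of
itself. -/
lemma mem_Sp_of_commute (g : V ≃ₗᵢ[ℝ] V) (h1 : ∀ x, g (H.J₁ x) = H.J₁ (g x))
    (h2 : ∀ x, g (H.J₂ x) = H.J₂ (g x)) : g ∈ H.Sp := by
  rw [mem_Sp_iff]
  constructor
  · have e := g.toLinearIsometry.normDet_eq_one
    rw [LinearMap.normDet_eq_abs_det] at e
    exact (abs_of_nonneg (H.det_nonneg_of_commute _ h1)).symm.trans e
  · rintro A ⟨a, b, c, -, rfl⟩ x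
    simp [comb_apply, h1, h2, ← J₁_J₂]

variable {H}

/-- The quaternionic version of Witt's theorem: families of vectors with the same quaternionic
Gram matrix are related by an element of `Sp(n)`. -/
theorem exists_mem_Sp_of_sameGram {ι : Type*} (x y : ι → V)
    (h : ∀ a b, H.SameGram (x a, y a) (x b, y b)) : ∃ g ∈ H.Sp, ∀ a, g (x a) = y a := by
  -- A maximal compatible set of pairs containing the given ones will be the graph of the isometry.
  let Iso : Set (Set (V × V)) := {S | ∀ p ∈ S, ∀ q ∈ S, H.SameGram p q}
  obtain ⟨S, hxS, hS⟩ := zorn_subset_nonempty Iso (fun c hc hchain _ => ⟨⋃₀ c, by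
    rintro p ⟨s, hs, hp⟩ q ⟨t, ht, hq⟩
    rcases hchain.total hs ht with hst | hst
    · exact hc ht p (hst hp) q hq
    · exact hc hs p hp q (hst hq), fun s hs => Set.subset_sUnion_of_mem hs⟩)
    (Set.range fun a => (x a, y a)) (by
      rintro _ ⟨a, rfl⟩ _ ⟨b, rfl⟩; exact h a b)
  have hSS := hS.prop
  -- By maximality, a pair compatible with itself and with `S` already lies in `S`; this makes `S` a
  -- quaternionic subspace.
  have key (p : V × V) (hp : H.SameGram p p) (hpS : ∀ q ∈ S, H.SameGram p q) : p ∈ S := by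
    refine hS.le_of_ge (y := insert p S) ?_ (Set.subset_insert p S) (Set.mem_insert p S)
    rintro a (rfl | ha) b (rfl | hb)
    exacts [hp, hpS b hb, (hpS a ha).symm, hSS a ha b hb]
  have hadd {p q : V × V} (hp : p ∈ S) (hq : q ∈ S) : p + q ∈ S := by
    have hl (r) (hr : r ∈ S) : H.SameGram (p + q) r := (hSS p hp r hr).add_left (hSS q hq r hr)
    exact key _ ((hl p hp).symm.add_left (hl q hq).symm).symm hl
  have hsmul (r : ℝ) {p : V × V} (hp : p ∈ S) : r • p ∈ S := by
    have hl (q) (hq : q ∈ S) : H.SameGram (r • p) q := (hSS p hp q hq).smul_left r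
    exact key _ ((hl p hp).symm.smul_left r) hl
  have hJ₁ {p : V × V} (hp : p ∈ S) : (H.J₁ p.1, H.J₁ p.2) ∈ S := by
    have hl (q) (hq : q ∈ S) := (hSS p hp q hq).J₁_left
    exact key _ (hl p hp).symm.J₁_left hl
  have hJ₂ {p : V × V} (hp : p ∈ S) : (H.J₂ p.1, H.J₂ p.2) ∈ S := by
    have hl (q) (hq : q ∈ S) := (hSS p hp q hq).J₂_left
    exact key _ (hl p hp).symm.J₂_left hl
  have hJ₃ {p : V × V} (hp : p ∈ S) : (H.J₃ p.1, H.J₃ p.2) ∈ S := by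
    simpa using hJ₁ (hJ₂ hp)
  have h0 : (0 : V × V) ∈ S := key 0 (by simp [sameGram_self_iff]) (by simp [SameGram])
  let T : Submodule ℝ (V × V) :=
    { carrier := S, add_mem' := hadd, zero_mem' := h0, smul_mem' := fun r _ hp => hsmul r hp }
  have hnorm (p : T) : ‖p.1.1‖ = ‖p.1.2‖ := sameGram_self_iff.1 (hSS p.1 p.2 p.1 p.2)
  let π₁ : T →ₗ[ℝ] V := LinearMap.fst ℝ V V ∘ₗ T.subtype
  let π₂ : T →ₗ[ℝ] V := LinearMap.snd ℝ V V ∘ₗ T.subtype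
  have hi₁ : Function.Injective π₁ := by
    rw [injective_iff_map_eq_zero]
    intro p hp
    have h1 : p.1.1 = 0 := hp
    have h2 : p.1.2 = 0 := by rw [← norm_eq_zero, ← hnorm, h1, norm_zero]
    exact Subtype.ext (Prod.ext h1 h2)
  have hi₂ : Function.Injective π₂ := by
    rw [injective_iff_map_eq_zero]
    intro p hp
    have h2 : p.1.2 = 0 := hp
    have h1 : p.1.1 = 0 := by rw [← norm_eq_zero, hnorm, h2, norm_zero]
    exact Subtype.ext (Prod.ext h1 h2)
  -- Both projections have the same rank. If it were deficient, normal vectors to the two ranges,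
  -- scaled to equal norm, would form a new compatible pair.
  have hr₁ : LinearMap.range π₁ = ⊤ := by
    by_contra hne
    have hne₂ : LinearMap.range π₂ ≠ ⊤ := by
      intro hr
      apply hne
      apply Submodule.eq_top_of_finrank_eq
      rw [LinearMap.finrank_range_of_inj hi₁, ← LinearMap.finrank_range_of_inj hi₂, hr,
        finrank_top]
    obtain ⟨u, hu, hu0⟩ := Submodule.exists_mem_ne_zero_of_ne_bot
      (mt Submodule.orthogonal_eq_bot_iff.1 hne)
    obtain ⟨w, hw, hw0⟩ := Submodule.exists_mem_ne_zero_of_ne_bot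
      (mt Submodule.orthogonal_eq_bot_iff.1 hne₂)
    rw [Submodule.mem_orthogonal'] at hu hw
    have hu' (q : V × V) (hq : q ∈ S) : inner ℝ u q.1 = 0 := hu _ ⟨⟨q, hq⟩, rfl⟩
    have hw' (q : V × V) (hq : q ∈ S) : inner ℝ w q.2 = 0 := hw _ ⟨⟨q, hq⟩, rfl⟩
    have hmem : (u, (‖u‖ / ‖w‖) • w) ∈ S := by
      apply key
      · rw [sameGram_self_iff, norm_smul, Real.norm_of_nonneg (by positivity),
          div_mul_cancel₀ _ (norm_ne_zero_iff.2 hw0)]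
      · intro q hq
        simp [SameGram, inner_smul_left, hu' q hq, hw' q hq, hu' _ (hJ₁ hq), hw' _ (hJ₁ hq),
          hu' _ (hJ₂ hq), hw' _ (hJ₂ hq), hu' _ (hJ₃ hq), hw' _ (hJ₃ hq)]
    exact hu0 (inner_self_eq_zero.1 (hu' _ hmem))
  let e : T ≃ₗ[ℝ] V := LinearEquiv.ofBijective π₁ ⟨hi₁, LinearMap.range_eq_top.1 hr₁⟩
  have he (p : V × V) (hp : p ∈ S) : π₂ (e.symm p.1) = p.2 := by
    have : e ⟨p, hp⟩ = p.1 := rfl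
    rw [← this, e.symm_apply_apply]; rfl
  let g₀ : V →ₗᵢ[ℝ] V :=
    { toLinearMap := π₂ ∘ₗ e.symm.toLinearMap
      norm_map' := fun v => by
        change ‖(e.symm v).1.2‖ = _
        rw [← hnorm]
        exact congrArg norm (e.apply_symm_apply v) }
  let g : V ≃ₗᵢ[ℝ] V := g₀.toLinearIsometryEquiv rfl
  have hg (p : V × V) (hp : p ∈ S) : g p.1 = p.2 := he p hp
  -- The graph lies in `S`, so closure of `S` under J₁ and J₂ yields commutation.
  have hgr (v : V) : ((v, g v) : V × V) ∈ S := by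
    have := (e.symm v).2
    have h1 : (e.symm v).1 = (v, g v) := Prod.ext (e.apply_symm_apply v) rfl
    rwa [h1] at this
  exact ⟨g, H.mem_Sp_of_commute g (fun v => hg _ (hJ₁ (hgr v))) (fun v => hg _ (hJ₂ (hgr v))),
    fun a => hg _ (hxS ⟨a, rfl⟩)⟩

end Isometries
end HermitianHypercomplex

namespace HermitianHypercomplex

/-! ### Kähler angles and decomposition of a complex subspace into blocks. -/

section KahlerAngles

variable {V : Type*} [NormedAddCommGroup V] [InnerProductSpace ℝ V]
  {H : HermitianHypercomplex V}

lemma HermitianOrtho.mono {A A' B B' : Submodule ℝ V} (hA : A ≤ A') (hB : B ≤ B')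
    (h : H.HermitianOrtho A' B') : H.HermitianOrtho A B := by
  rw [hermitianOrtho_iff] at h ⊢
  exact fun a ha b hb => h a (hA ha) b (hB hb)

lemma HermitianOrtho.isOrtho {A B : Submodule ℝ V} (h : H.HermitianOrtho A B) : A ⟂ B :=
  Submodule.isOrtho_iff_inner_eq.2 fun a ha b hb => (hermitianOrtho_iff.1 h a ha b hb).1

variable (H) in
/-- The `J₁`-complex line spanned by `x`. -/
def line (x : V) : Submodule ℝ V := Submodule.span ℝ {x, H.J₁ x}

lemma mem_line {x z : V} : z ∈ H.line x ↔ ∃ a b : ℝ, a • x + b • H.J₁ x = z :=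
  Submodule.mem_span_pair

lemma self_mem_line (x : V) : x ∈ H.line x := Submodule.subset_span (by simp)

lemma isComplex_line (x : V) : IsComplex H.J₁ (H.line x) := by
  rw [isComplex_iff H.J₁_mem_sphere]
  intro z hz
  obtain ⟨a, b, rfl⟩ := mem_line.1 hz
  exact mem_line.2 ⟨-b, a, by simp; abel⟩

lemma line_le {x : V} {P : Submodule ℝ V} (hP : IsComplex H.J₁ P) (hx : x ∈ P) :
    H.line x ≤ P := by
  rw [isComplex_iff H.J₁_mem_sphere] at hP
  rw [line, Submodule.span_le]
  rintro z (rfl | rfl)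
  exacts [hx, hP x hx]

lemma finrank_line {x : V} (hx : x ≠ 0) : finrank ℝ (H.line x) = 2 := by
  have hJ : H.J₁ x ≠ 0 := fun h => hx (by
    have := H.J₁_J₁ x
    rwa [h, map_zero, zero_eq_neg] at this)
  have hli : LinearIndependent ℝ ![x, H.J₁ x] := by
    rw [LinearIndependent.pair_iff]
    intro s t h
    have h1 := congrArg (fun z => inner ℝ x z) h
    have h2 := congrArg (fun z => inner ℝ (H.J₁ x) z) h
    simp [inner_add_right, inner_smul_right, inner_J₁_self, inner_J₁_left, hx, hJ] at h1 h2
    exact ⟨h1, h2⟩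
  have e : Set.range ![x, H.J₁ x] = {x, H.J₁ x} := by
    ext z; simp [eq_comm, or_comm]
  rw [line, ← e, finrank_span_eq_card hli, Fintype.card_fin]

lemma line_isOrtho {x y : V} (h0 : inner ℝ x y = 0) (h1 : inner ℝ x (H.J₁ y) = 0) :
    H.line x ⟂ H.line y := by
  rw [Submodule.isOrtho_iff_inner_eq]
  intro u hu v hv
  obtain ⟨a, b, rfl⟩ := mem_line.1 hu
  obtain ⟨c, d, rfl⟩ := mem_line.1 hv
  simp [inner_add_left, inner_add_right, inner_smul_left, inner_smul_right, inner_J₁_left, h0, h1]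

lemma IsComplex.sup {A : End ℝ V} {P Q : Submodule ℝ V} (hP : IsComplex A P)
    (hQ : IsComplex A Q) : IsComplex A (P ⊔ Q) := by
  rw [IsComplex, Submodule.map_sup, hP, hQ]

lemma finrank_sup_of_isOrtho [FiniteDimensional ℝ V] {P Q : Submodule ℝ V} (h : P ⟂ Q) :
    finrank ℝ ↥(P ⊔ Q) = finrank ℝ P + finrank ℝ Q := by
  rw [← Submodule.finrank_sup_add_finrank_inf_eq, h.disjoint.eq_bot, finrank_bot, add_zero]

lemma finrank_map_of_injective {f : V →ₗ[ℝ] V} (hf : Function.Injective f) (U : Submodule ℝ V) :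
    finrank ℝ (U.map f) = finrank ℝ U :=
  (Submodule.equivMapOfInjective f hf U).finrank_eq.symm

lemma injective_of_mem_sphere {A : End ℝ V} (hA : A ∈ H.sphere) : Function.Injective A := by
  intro x y h
  have := congrArg A h
  rwa [sphere_sq hA, sphere_sq hA, neg_inj] at this

lemma norm_sq_quad {x y : V} (hx : ‖x‖ = 1) (hy : ‖y‖ = 1) (h0 : inner ℝ x y = 0)
    (h1 : inner ℝ x (H.J₁ y) = 0) (a b c d : ℝ) :
    ‖(a • x + b • H.J₁ x) + (c • y + d • H.J₁ y)‖ ^ 2 = a ^ 2 + b ^ 2 + c ^ 2 + d ^ 2 := by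
  have h0' : inner ℝ y x = 0 := by rw [real_inner_comm, h0]
  have h1' : inner ℝ y (H.J₁ x) = 0 := by rw [real_inner_comm, inner_J₁_left, h1, neg_zero]
  rw [← real_inner_self_eq_norm_sq]
  simp only [inner_add_left, inner_add_right, inner_smul_left, inner_smul_right, inner_J₁_left,
    inner_J₁_self, h0, h1, h0', h1', J₁_J₁, inner_neg_right, real_inner_self_eq_norm_sq, hx, hy,
    norm_sphere H.J₁_mem_sphere,    RCLike.conj_to_real]
  ring

lemma exists_unit_mem {P : Submodule ℝ V} (h : P ≠ ⊥) : ∃ x ∈ P, ‖x‖ = 1 := by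
  obtain ⟨x, hx, hx0⟩ := Submodule.exists_mem_ne_zero_of_ne_bot h
  exact ⟨‖x‖⁻¹ • x, P.smul_mem _ hx, norm_smul_inv_norm hx0⟩

variable [FiniteDimensional ℝ V]

/-- The projection is conjugated by the isometry A, whose inverse is -A. -/
lemma starProjection_map_sphere {A : End ℝ V} (hA : A ∈ H.sphere) (U : Submodule ℝ V) (x : V) :
    (U.map A).starProjection x = -A (U.starProjection (A x)) := by
  apply Submodule.eq_starProjection_of_mem_of_inner_eq_zero
  · exact neg_mem (Submodule.mem_map_of_mem (U.starProjection_apply_mem _))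
  · rintro _ ⟨y, hy, rfl⟩
    have := U.starProjection_inner_eq_zero (A x) y hy
    rw [inner_sub_left, inner_sphere_left hA] at this
    rw [sub_neg_eq_add, inner_add_left, inner_sphere hA]
    linarith

lemma starProjection_sphere {A : End ℝ V} (hA : A ∈ H.sphere) {U : Submodule ℝ V}
    (hU : IsComplex A U) (x : V) : U.starProjection (A x) = A (U.starProjection x) := by
  have h := starProjection_map_sphere hA U x
  have h' : (U.map A).starProjection x = U.starProjection x := by
    have e : U.map A = U := hU
    congr!
  rw [h'] at h
  rw [h, map_neg, sphere_sq hA, neg_neg]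

variable (H) in
/-- The orthogonal projection of `J₂ x` to `P`. -/
noncomputable def kahlerMap (P : Submodule ℝ V) : V →ₗ[ℝ] V := P.starProjection.toLinearMap ∘ₗ H.J₂

lemma kahlerMap_apply (P : Submodule ℝ V) (x : V) :
    H.kahlerMap P x = P.starProjection (H.J₂ x) := rfl

lemma kahlerMap_mem (P : Submodule ℝ V) (x : V) : H.kahlerMap P x ∈ P :=
  P.starProjection_apply_mem _

lemma inner_kahlerMap_left {P : Submodule ℝ V} (x : V) {y : V} (hy : y ∈ P) :
    inner ℝ (H.kahlerMap P x) y = inner ℝ (H.J₂ x) y := by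
  have := P.starProjection_inner_eq_zero (H.J₂ x) y hy
  rw [inner_sub_left] at this
  rw [kahlerMap_apply]; linarith

lemma kahlerMap_skew {P : Submodule ℝ V} {x y : V} (hx : x ∈ P) (hy : y ∈ P) :
    inner ℝ (H.kahlerMap P x) y = -inner ℝ x (H.kahlerMap P y) := by
  rw [inner_kahlerMap_left x hy, real_inner_comm _ x, inner_kahlerMap_left y hx, inner_J₂_left,
    real_inner_comm]

/-- J₂ anticommutes with J₁, and the projection to a J₁-complex subspace commutes with it. -/
lemma kahlerMap_J₁ {P : Submodule ℝ V} (hP : IsComplex H.J₁ P) (x : V) :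
    H.kahlerMap P (H.J₁ x) = -H.J₁ (H.kahlerMap P x) := by
  rw [kahlerMap_apply, J₂_J₁, map_neg, ← J₁_J₂, starProjection_sphere H.J₁_mem_sphere hP,
    kahlerMap_apply]

/-- For K = bJ₂ + cJ₃ the projection of Kx to W is (b + cJ₁) applied to `kahlerMap W x`, of the same
norm. So K = J₂ alone decides. -/
lemma isKahlerAngle_iff {W : Submodule ℝ V} (hW : IsComplex H.J₁ W) {φ : ℝ} :
    H.IsKahlerAngle H.J₁ W φ ↔ 0 ≤ φ ∧ φ ≤ Real.pi / 2 ∧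
      ∀ x ∈ W, ‖H.kahlerMap W x‖ = Real.cos φ * ‖x‖ := by
  constructor
  · intro h
    obtain ⟨-, h0, h1, h2⟩ := h H.J₂ ⟨H.J₂_mem_sphere, by rw [H.anti₁₂]⟩
    refine ⟨h0, h1, fun x hx => ?_⟩
    rw [← h2 x hx, starProjection_map_sphere H.J₂_mem_sphere, norm_neg,
      norm_sphere H.J₂_mem_sphere, kahlerMap_apply]
  · rintro ⟨h0, h1, h2⟩ K ⟨hK, hKJ⟩
    refine ⟨(finrank_map_of_injective (injective_of_mem_sphere hK) W).symm, h0, h1,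
      fun x hx => ?_⟩
    rw [← h2 x hx, starProjection_map_sphere hK, norm_neg, norm_sphere hK]
    rcases eq_or_ne x 0 with rfl | hx0
    · simp
    obtain ⟨a, b, c, habc, rfl⟩ := hK
    -- Anticommutation with J₁ kills the J₁-coefficient of K.
    have ha : a = 0 := by
      have := LinearMap.congr_fun hKJ x
      simp only [Module.End.mul_apply, LinearMap.neg_apply, comb_apply, map_add, map_smul,
        J₁_J₁, J₁_J₂, J₁_J₃, J₂_J₁, J₃_J₁] at this
      have h3 : (2 * a) • x = 0 := by
        rw [← neg_eq_zero, ← sub_eq_zero.2 this]; module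
      simpa [hx0] using h3
    subst ha
    have e : W.starProjection (H.comb 0 b c x) =
        b • H.kahlerMap W x + c • H.J₁ (H.kahlerMap W x) := by
      rw [comb_apply, ← J₁_J₂, map_add, map_add, map_smul, map_smul, map_smul,
        kahlerMap_apply, zero_smul, zero_add,
        starProjection_sphere H.J₁_mem_sphere hW]
    have e2 : ‖b • H.kahlerMap W x + c • H.J₁ (H.kahlerMap W x)‖ ^ 2 =
        ‖H.kahlerMap W x‖ ^ 2 := by
      rw [← real_inner_self_eq_norm_sq, ← real_inner_self_eq_norm_sq]
      simp only [inner_add_left, inner_add_right, inner_smul_left, inner_smul_right,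
        inner_J₁_left, inner_J₁_self, J₁_J₁, inner_neg_right, RCLike.conj_to_real]
      linear_combination inner ℝ (H.kahlerMap W x) (H.kahlerMap W x) * habc
    rw [e]
    exact (sq_eq_sq₀ (norm_nonneg _) (norm_nonneg _)).1 e2

lemma exists_unit_orthogonal_line {P : Submodule ℝ V} (hP : IsComplex H.J₁ P)
    (hd : 2 < finrank ℝ P) {x : V} (hx : x ∈ P) (hx0 : x ≠ 0) :
    ∃ y ∈ P, ‖y‖ = 1 ∧ inner ℝ x y = 0 ∧ inner ℝ x (H.J₁ y) = 0 := by
  have h := Submodule.finrank_add_inf_finrank_orthogonal (line_le hP hx)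
  rw [finrank_line hx0] at h
  have hne : (H.line x)ᗮ ⊓ P ≠ ⊥ := by
    intro hb
    rw [hb, finrank_bot] at h; omega
  obtain ⟨y, hy, hy0⟩ := Submodule.exists_mem_ne_zero_of_ne_bot hne
  have h0 : inner ℝ x y = 0 := hy.1 x (self_mem_line x)
  have h1 : inner ℝ x (H.J₁ y) = 0 := by
    have := hy.1 (H.J₁ x) (mem_line.2 ⟨0, 1, by simp⟩)
    rwa [inner_J₁_left, neg_eq_zero] at this
  refine ⟨‖y‖⁻¹ • y, P.smul_mem _ hy.2, norm_smul_inv_norm hy0, ?_, ?_⟩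
  · rw [inner_smul_right, h0, mul_zero]
  · rw [map_smul, inner_smul_right, h1, mul_zero]

lemma finrank_quad {x y : V} (hx : x ≠ 0) (hy : y ≠ 0) (h0 : inner ℝ x y = 0)
    (h1 : inner ℝ x (H.J₁ y) = 0) : finrank ℝ ↥(H.line x ⊔ H.line y) = 4 := by
  rw [finrank_sup_of_isOrtho (line_isOrtho h0 h1), finrank_line hx, finrank_line hy]

/-- A normal form of the map `kahlerMap P` on a four-dimensional invariant subspace. -/
lemma exists_kahlerMap_normal {P : Submodule ℝ V} (hP : IsComplex H.J₁ P)
    (hd : 2 < finrank ℝ P) : ∃ x ∈ P, ∃ y ∈ P, ∃ c : ℝ, ‖x‖ = 1 ∧ ‖y‖ = 1 ∧ inner ℝ x y = 0 ∧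
      inner ℝ x (H.J₁ y) = 0 ∧ 0 ≤ c ∧ c ≤ 1 ∧ H.kahlerMap P x = c • y ∧
      H.kahlerMap P y = -c • x := by
  by_cases hA : ∀ x ∈ P, H.kahlerMap P x = 0
  · have hne : P ≠ ⊥ := by
      rintro rfl
      simp at hd
    obtain ⟨x, hx, hx1⟩ := exists_unit_mem hne
    obtain ⟨y, hy, hy1, h0, h1⟩ :=
      exists_unit_orthogonal_line hP hd hx (norm_ne_zero_iff.1 (by rw [hx1]; exact one_ne_zero))
    exact ⟨x, hx, y, hy, 0, hx1, hy1, h0, h1, le_rfl, zero_le_one, by simp [hA x hx],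
      by simp [hA y hy]⟩
  push Not at hA
  obtain ⟨z, hz, hz0⟩ := hA
  let A : P →ₗ[ℝ] P := (H.kahlerMap P).restrict fun x _ => kahlerMap_mem P x
  have hAskew (x y : P) : inner ℝ (A x) y = -inner ℝ x (A y) := kahlerMap_skew x.2 y.2
  -- The square of a skew map is symmetric. For a unit eigenvector x with eigenvalue μ ≠ 0, take c =
  -- ‖Ax‖ and y = Ax / c; then μ = -c².
  have hT : (A ∘ₗ A).IsSymmetric := fun x y => by
    simp only [LinearMap.comp_apply]
    rw [hAskew, hAskew, neg_neg]
  obtain ⟨i, hi⟩ : ∃ i, hT.eigenvalues rfl i ≠ 0 := by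
    -- Otherwise A² = 0, and skewness gives ‖Az‖² = -⟨z, A²z⟩ = 0.
    by_contra! hall
    have h0 : A ∘ₗ A = 0 := (hT.eigenvectorBasis rfl).toBasis.ext fun i => by
      simp [hall i]
    have h1 : inner ℝ (A ⟨z, hz⟩) (A ⟨z, hz⟩) = 0 := by
      rw [hAskew]
      have := LinearMap.congr_fun h0 ⟨z, hz⟩
      simp only [LinearMap.comp_apply] at this
      simp [this]
    exact hz0 (congrArg Subtype.val (inner_self_eq_zero.1 h1))
  set x := hT.eigenvectorBasis rfl i with hxdef
  set μ := hT.eigenvalues rfl i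
  have hx1 : ‖x‖ = 1 := (hT.eigenvectorBasis rfl).orthonormal.1 i
  have hAA : A (A x) = μ • x := hT.apply_eigenvectorBasis rfl i
  have hμ : μ = -‖A x‖ ^ 2 := by
    have h1 := hAskew (A x) x
    rw [hAA, inner_smul_left, real_inner_self_eq_norm_sq, real_inner_self_eq_norm_sq, hx1] at h1
    simpa using h1
  have hc0 : ‖A x‖ ≠ 0 := fun h => hi (by rw [hμ, h]; simp)
  have hin (u : P) : inner ℝ u (A u) = 0 := by
    have := hAskew u u
    rw [real_inner_comm] at this; linarith
  refine ⟨x, x.2, ‖A x‖⁻¹ • A x, (‖A x‖⁻¹ • A x).2, ‖A x‖, hx1, ?_, ?_, ?_, norm_nonneg _, ?_,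
    ?_, ?_⟩
  · change ‖‖A x‖⁻¹ • A x‖ = 1
    rw [norm_smul, norm_inv, norm_norm,
      inv_mul_cancel₀ hc0]
  · rw [inner_smul_right]
    change _ * inner ℝ x (A x) = 0
    rw [hin, mul_zero]
  · rw [map_smul, inner_smul_right]
    change _ * inner ℝ (x : V) (H.J₁ (H.kahlerMap P x)) = 0
    rw [real_inner_comm, inner_J₁_left,
      inner_kahlerMap_left _ ((isComplex_iff H.J₁_mem_sphere).1 hP x x.2), inner_J₂_left, J₂_J₁,
      inner_neg_right, inner_J₃_self]
    simp
  · change ‖P.starProjection (H.J₂ x)‖ ≤ 1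
    refine (P.norm_starProjection_apply_le _).trans ?_
    rw [norm_sphere H.J₂_mem_sphere]
    exact hx1.le
  · change (A x : V) = _
    rw [smul_inv_smul₀ hc0]
  · rw [map_smul]
    change _ • ((A (A x) : P) : V) = _
    rw [hAA, hμ, Submodule.coe_smul, smul_smul]
    congr 1
    field_simp

lemma kahlerMap_eq_of_mem {W P : Submodule ℝ V} (hWP : W ≤ P) {x : V}
    (h : H.kahlerMap P x ∈ W) : H.kahlerMap W x = H.kahlerMap P x := by
  rw [kahlerMap_apply]
  apply Submodule.eq_starProjection_of_mem_of_inner_eq_zero h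
  intro w hw
  rw [inner_sub_left, inner_kahlerMap_left x (hWP hw), sub_self]

/-- For a in W and b in P, the product of J₂a with b is that of `kahlerMap P a` with b, which
vanishes if b ⟂ W by invariance. J₁-invariance of W covers J₁ and J₃ = J₁J₂. -/
lemma hermitianOrtho_of_kahlerMap_mem {W P : Submodule ℝ V}
    (hW : IsComplex H.J₁ W) (h : ∀ x ∈ W, H.kahlerMap P x ∈ W) :
    H.HermitianOrtho W (Wᗮ ⊓ P) := by
  rw [isComplex_iff H.J₁_mem_sphere] at hW
  rw [hermitianOrtho_iff]
  rintro a ha b ⟨hb, hbP⟩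
  have h2 (a : V) (ha : a ∈ W) : inner ℝ a (H.J₂ b) = 0 := by
    rw [← neg_eq_zero, ← inner_J₂_left, ← inner_kahlerMap_left a hbP]
    exact hb _ (h a ha)
  refine ⟨hb a ha, ?_, h2 a ha, ?_⟩
  · rw [← neg_eq_zero, ← inner_J₁_left]
    exact hb _ (hW a ha)
  · rw [← J₁_J₂, ← neg_eq_zero, ← inner_J₁_left]
    exact h2 _ (hW a ha)

variable (H) in
/-- A decomposition of the `J₁`-complex subspace `P` into Hermitian orthogonal addends: the
four-dimensional subspaces `B j` with Kähler angles `φ j`, and a subspace `C` of dimension at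
most two. -/
structure IsBlockDecomposition (P : Submodule ℝ V) {k : ℕ} (B : Fin k → Submodule ℝ V)
    (φ : Fin k → ℝ) (C : Submodule ℝ V) : Prop where
  finrank_block : ∀ j, finrank ℝ (B j) = 4
  complex_block : ∀ j, IsComplex H.J₁ (B j)
  angle : ∀ j, H.IsKahlerAngle H.J₁ (B j) (φ j)
  ortho : ∀ j l, j ≠ l → H.HermitianOrtho (B j) (B l)
  ortho_rest : ∀ j, H.HermitianOrtho (B j) C
  complex_rest : IsComplex H.J₁ C
  finrank_rest : finrank ℝ C = 0 ∨ finrank ℝ C = 2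
  sup_eq : (⨆ j, B j) ⊔ C = P

/-- The complex lines of x and y from the normal form span an invariant W on which `kahlerMap` is c
times an isometry, so the angle is arccos c. Invariance makes the rest Hermitian orthogonal. -/
lemma exists_block {P : Submodule ℝ V} (hP : IsComplex H.J₁ P) (hd : 2 < finrank ℝ P) :
    ∃ W ≤ P, ∃ φ : ℝ, finrank ℝ W = 4 ∧ IsComplex H.J₁ W ∧ H.IsKahlerAngle H.J₁ W φ ∧
      H.HermitianOrtho W (Wᗮ ⊓ P) := by
  obtain ⟨x, hx, y, hy, c, hx1, hy1, h0, h1, hc0, hc1, hAx, hAy⟩ := exists_kahlerMap_normal hP hd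
  have hx0 : x ≠ 0 := norm_ne_zero_iff.1 (by rw [hx1]; exact one_ne_zero)
  have hy0 : y ≠ 0 := norm_ne_zero_iff.1 (by rw [hy1]; exact one_ne_zero)
  have hW := (isComplex_line (H := H) x).sup (isComplex_line y)
  have hWP : H.line x ⊔ H.line y ≤ P := sup_le (line_le hP hx) (line_le hP hy)
  have hA (a b a' b' : ℝ) : H.kahlerMap P ((a • x + b • H.J₁ x) + (a' • y + b' • H.J₁ y)) =
      ((-(c * a')) • x + (c * b') • H.J₁ x) + ((c * a) • y + (-(c * b)) • H.J₁ y) := by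
    simp only [map_add, map_smul, kahlerMap_J₁ hP, hAx, hAy]
    module
  have hmem : ∀ w ∈ H.line x ⊔ H.line y, H.kahlerMap P w ∈ H.line x ⊔ H.line y := by
    intro w hw
    obtain ⟨u, hu, v, hv, rfl⟩ := Submodule.mem_sup.1 hw
    obtain ⟨a, b, rfl⟩ := mem_line.1 hu
    obtain ⟨a', b', rfl⟩ := mem_line.1 hv
    rw [hA]
    exact Submodule.add_mem_sup (mem_line.2 ⟨_, _, rfl⟩) (mem_line.2 ⟨_, _, rfl⟩)
  refine ⟨_, hWP, Real.arccos c, finrank_quad hx0 hy0 h0 h1, hW, ?_,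
    hermitianOrtho_of_kahlerMap_mem hW hmem⟩
  rw [isKahlerAngle_iff hW]
  refine ⟨Real.arccos_nonneg c, Real.arccos_le_pi_div_two.2 hc0, fun w hw => ?_⟩
  rw [kahlerMap_eq_of_mem hWP (hmem w hw), Real.cos_arccos (by linarith) hc1]
  obtain ⟨u, hu, v, hv, rfl⟩ := Submodule.mem_sup.1 hw
  obtain ⟨a, b, rfl⟩ := mem_line.1 hu
  obtain ⟨a', b', rfl⟩ := mem_line.1 hv
  rw [← sq_eq_sq₀ (norm_nonneg _) (by positivity), hA, mul_pow, norm_sq_quad hx1 hy1 h0 h1,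
    norm_sq_quad hx1 hy1 h0 h1]
  ring

/-- Blocks are split off while the dimension exceeds two; dimension one cannot remain, since a
nonzero vector brings its complex line. -/
lemma exists_isBlockDecomposition {P : Submodule ℝ V} (hP : IsComplex H.J₁ P) :
    ∃ (k : ℕ) (B : Fin k → Submodule ℝ V) (φ : Fin k → ℝ) (C : Submodule ℝ V),
      H.IsBlockDecomposition P B φ C := by
  induction hN : finrank ℝ P using Nat.strong_induction_on generalizing P with
  | _ N ih =>
  by_cases hd : 2 < finrank ℝ P
  · obtain ⟨W, hWP, φ₀, hW4, hW, hφ₀, hWo⟩ := exists_block hP hd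
    have hfr := Submodule.finrank_add_inf_finrank_orthogonal hWP
    have hP' : IsComplex H.J₁ (Wᗮ ⊓ P) := by
      rw [isComplex_iff H.J₁_mem_sphere] at hP hW ⊢
      rintro z ⟨hz, hzP⟩
      refine ⟨fun w hw => ?_, hP z hzP⟩
      rw [← neg_eq_zero, ← inner_J₁_left]
      exact hz _ (hW w hw)
    obtain ⟨k, B, φ, C, hB⟩ := ih _ (by omega) hP' rfl
    have hBle (j) : B j ≤ Wᗮ ⊓ P :=
      hB.sup_eq ▸ (le_iSup B j).trans le_sup_left
    have hCle : C ≤ Wᗮ ⊓ P := hB.sup_eq ▸ le_sup_right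
    refine ⟨k + 1, Fin.cons W B, Fin.cons φ₀ φ, C, ?_, ?_, ?_, ?_, ?_, hB.complex_rest,
      hB.finrank_rest, ?_⟩
    · exact Fin.cases hW4 hB.finrank_block
    · exact Fin.cases hW hB.complex_block
    · exact Fin.cases hφ₀ hB.angle
    · refine Fin.cases (Fin.cases (fun h => absurd rfl h) fun l _ => ?_) fun j =>
        Fin.cases (fun _ => ?_) fun l h => ?_
      · exact hWo.mono le_rfl (hBle l)
      · exact (hWo.mono le_rfl (hBle j)).symm
      · exact hB.ortho j l fun e => h (by rw [e])
    · exact Fin.cases (hWo.mono le_rfl hCle) hB.ortho_rest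
    · have : (⨆ j, (Fin.cons W B : Fin (k + 1) → Submodule ℝ V) j) = W ⊔ ⨆ j, B j := by
        apply le_antisymm
        · exact iSup_le (Fin.cases le_sup_left fun j => (le_iSup B j).trans le_sup_right)
        · refine sup_le (le_iSup (Fin.cons W B : Fin (k + 1) → Submodule ℝ V) 0)
            (iSup_le fun j => le_iSup (Fin.cons W B : Fin (k + 1) → Submodule ℝ V) j.succ)
      rw [this, sup_assoc, hB.sup_eq, Submodule.sup_orthogonal_inf_of_hasOrthogonalProjection hWP]
  · refine ⟨0, Fin.elim0, Fin.elim0, P, fun j => j.elim0, fun j => j.elim0, fun j => j.elim0,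
      fun j => j.elim0, fun j => j.elim0, hP, ?_, by simp⟩
    by_cases h0 : P = ⊥
    · left; rw [h0, finrank_bot]
    · obtain ⟨x, hx, hx0⟩ := Submodule.exists_mem_ne_zero_of_ne_bot h0
      have := Submodule.finrank_mono (line_le hP hx)
      rw [finrank_line hx0] at this
      right; omega

end KahlerAngles
end HermitianHypercomplex

namespace HermitianHypercomplex

/-! ### Finite orthogonal sums. -/

section Families

variable {V : Type*} [NormedAddCommGroup V] [InnerProductSpace ℝ V]

lemma exists_sum_of_mem_iSup {ι : Type*} [Fintype ι] {D : ι → Submodule ℝ V} {x : V}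
    (hx : x ∈ ⨆ i, D i) : ∃ f : ι → V, (∀ i, f i ∈ D i) ∧ ∑ i, f i = x := by
  obtain ⟨f, hf, rfl⟩ := (Submodule.mem_iSup_iff_exists_finsupp D x).1 hx
  exact ⟨f, hf, (Finsupp.sum_fintype f (fun _ x => x) fun _ => rfl).symm⟩

lemma eq_zero_of_sum_eq_zero {ι : Type*} [Fintype ι] {D : ι → Submodule ℝ V}
    (hD : ∀ i j, i ≠ j → D i ⟂ D j) {f : ι → V} (hf : ∀ i, f i ∈ D i) (h : ∑ i, f i = 0)
    (i : ι) : f i = 0 := by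
  rw [← inner_self_eq_zero (𝕜 := ℝ)]
  have h1 : inner ℝ (f i) (∑ j, f j) = inner ℝ (f i) (f i) := by
    rw [inner_sum]
    exact Fintype.sum_eq_single i fun j hj =>
      Submodule.isOrtho_iff_inner_eq.1 (hD i j hj.symm) _ (hf i) _ (hf j)
  rw [← h1, h, inner_zero_right]

lemma finrank_iSup_of_isOrtho [FiniteDimensional ℝ V] {ι : Type*} [Fintype ι]
    {D : ι → Submodule ℝ V} (hD : ∀ i j, i ≠ j → D i ⟂ D j) :
    finrank ℝ ↥(⨆ i, D i) = ∑ i, finrank ℝ (D i) := by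
  classical
  have key (s : Finset ι) : finrank ℝ ↥(⨆ i ∈ s, D i) = ∑ i ∈ s, finrank ℝ (D i) := by
    induction s using Finset.induction_on with
    | empty => simp
    | insert a s ha ih =>
      rw [Finset.iSup_insert, Finset.sum_insert ha, finrank_sup_of_isOrtho, ih]
      simp only [Submodule.isOrtho_iSup_right]
      exact fun i hi => hD a i fun e => ha (e ▸ hi)
  have e : ⨆ i ∈ Finset.univ, D i = ⨆ i, D i := by simp
  rw [← e, key]

end Families

/-! ### Conjugacy of complex subspaces under Sp(n), and uniqueness of the angles. -/

section Conjugacy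

variable {V : Type*} [NormedAddCommGroup V] [InnerProductSpace ℝ V]
  {H : HermitianHypercomplex V}

lemma Sp_apply_sphere {g : V ≃ₗᵢ[ℝ] V} (hg : g ∈ H.Sp) {A : End ℝ V} (hA : A ∈ H.sphere)
    (x : V) : g (A x) = A (g x) :=
  (mem_Sp_iff.1 hg).2 A hA x

lemma sameGram_apply {g : V ≃ₗᵢ[ℝ] V} (hg : g ∈ H.Sp) (u v : V) :
    H.SameGram (u, g u) (v, g v) := by
  simp only [SameGram, ← Sp_apply_sphere hg H.J₁_mem_sphere, ← Sp_apply_sphere hg H.J₂_mem_sphere,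
    ← Sp_apply_sphere hg H.J₃_mem_sphere, g.inner_map_map, and_self]

lemma sameGram_of_hermitianOrtho {A B A' B' : Submodule ℝ V} (h : H.HermitianOrtho A B)
    (h' : H.HermitianOrtho A' B') {a b a' b' : V} (ha : a ∈ A) (hb : b ∈ B) (ha' : a' ∈ A')
    (hb' : b' ∈ B') : H.SameGram (a, a') (b, b') := by
  obtain ⟨h0, h1, h2, h3⟩ := hermitianOrtho_iff.1 h a ha b hb
  obtain ⟨h0', h1', h2', h3'⟩ := hermitianOrtho_iff.1 h' a' ha' b' hb'
  simp [SameGram, *]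

lemma map_line {g : V ≃ₗᵢ[ℝ] V} (hg : g ∈ H.Sp) (x : V) :
    (H.line x).map (g.toLinearEquiv : V →ₗ[ℝ] V) = H.line (g x) := by
  rw [line, Submodule.map_span, Set.image_pair, line, ← Sp_apply_sphere hg H.J₁_mem_sphere]
  rfl

variable [FiniteDimensional ℝ V]

/-- Isometries of Hermitian orthogonal addends can be glued. -/
lemma exists_mem_Sp_map_eq {κ : Type*} {B B' : κ → Submodule ℝ V}
    (hB : ∀ i j, i ≠ j → H.HermitianOrtho (B i) (B j))
    (hB' : ∀ i j, i ≠ j → H.HermitianOrtho (B' i) (B' j))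
    (h : ∀ i, ∃ g ∈ H.Sp, (B i).map (g.toLinearEquiv : V →ₗ[ℝ] V) = B' i) :
    ∃ g ∈ H.Sp, ∀ i, (B i).map (g.toLinearEquiv : V →ₗ[ℝ] V) = B' i := by
  choose g hg hgB using h
  have hmem (i : κ) {b : V} (hb : b ∈ B i) : g i b ∈ B' i := by
    rw [← hgB]; exact Submodule.mem_map_of_mem (f := ((g i).toLinearEquiv : V →ₗ[ℝ] V)) hb
  -- Witt's theorem is applied to all vectors of all addends: inside one addend `g i` preserves the
  -- Gram data, and across addends all products vanish on both sides.
  obtain ⟨G, hG, hGx⟩ := exists_mem_Sp_of_sameGram (H := H)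
    (fun p : Σ i, B i => (p.2 : V)) (fun p => g p.1 p.2) (by
      rintro ⟨i, a⟩ ⟨j, b⟩
      by_cases e : i = j
      · subst e; exact sameGram_apply (hg i) _ _
      · exact sameGram_of_hermitianOrtho (hB i j e) (hB' i j e) a.2 b.2 (hmem i a.2)
          (hmem j b.2))
  refine ⟨G, hG, fun i => ?_⟩
  rw [← hgB]
  ext z
  simp only [Submodule.mem_map]
  constructor
  · rintro ⟨b, hb, rfl⟩; exact ⟨b, hb, (hGx ⟨i, b, hb⟩).symm⟩
  · rintro ⟨b, hb, rfl⟩; exact ⟨b, hb, hGx ⟨i, b, hb⟩⟩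

/-- A normal form of a four-dimensional complex subspace with a Kähler angle. -/
lemma IsKahlerAngle.exists_normal {W : Submodule ℝ V} {φ : ℝ} (h : H.IsKahlerAngle H.J₁ W φ)
    (hW : IsComplex H.J₁ W) (hd : finrank ℝ W = 4) : ∃ x y : V, ‖x‖ = 1 ∧ ‖y‖ = 1 ∧
      inner ℝ x y = 0 ∧ inner ℝ x (H.J₁ y) = 0 ∧ H.kahlerMap W x = Real.cos φ • y ∧
      H.kahlerMap W y = -Real.cos φ • x ∧ W = H.line x ⊔ H.line y := by
  obtain ⟨x, hx, y, hy, c, hx1, hy1, h0, h1, hc0, hc1, hAx, hAy⟩ :=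
    exists_kahlerMap_normal hW (by omega)
  have hc : c = Real.cos φ := by
    have := ((isKahlerAngle_iff hW).1 h).2.2 x hx
    rwa [hAx, norm_smul, hy1, hx1, mul_one, mul_one, Real.norm_of_nonneg hc0] at this
  subst hc
  refine ⟨x, y, hx1, hy1, h0, h1, hAx, hAy, ?_⟩
  symm
  apply Submodule.eq_of_le_of_finrank_eq (sup_le (line_le hW hx) (line_le hW hy))
  rw [finrank_quad (norm_ne_zero_iff.1 (by rw [hx1]; exact one_ne_zero))
    (norm_ne_zero_iff.1 (by rw [hy1]; exact one_ne_zero)) h0 h1, hd]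

/-- In normal form, the products of x with y, J₁y, J₂y, J₃y are 0, 0, -cos φ, 0, so the quaternionic
Gram matrix of the generators depends on φ only. -/
lemma exists_mem_Sp_map_block {W W' : Submodule ℝ V} {φ : ℝ} (hW : IsComplex H.J₁ W)
    (hd : finrank ℝ W = 4) (h : H.IsKahlerAngle H.J₁ W φ) (hW' : IsComplex H.J₁ W')
    (hd' : finrank ℝ W' = 4) (h' : H.IsKahlerAngle H.J₁ W' φ) :
    ∃ g ∈ H.Sp, W.map (g.toLinearEquiv : V →ₗ[ℝ] V) = W' := by
  have key {W : Submodule ℝ V} (hW : IsComplex H.J₁ W) (hd : finrank ℝ W = 4)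
      (h : H.IsKahlerAngle H.J₁ W φ) : ∃ x y : V, W = H.line x ⊔ H.line y ∧ ‖x‖ = 1 ∧ ‖y‖ = 1 ∧
      inner ℝ x y = 0 ∧ inner ℝ x (H.J₁ y) = 0 ∧ inner ℝ x (H.J₂ y) = -Real.cos φ ∧
      inner ℝ x (H.J₃ y) = 0 := by
    obtain ⟨x, y, hx1, hy1, h0, h1, hAx, hAy, hl⟩ := h.exists_normal hW hd
    have hy : y ∈ W := hl ▸ Submodule.mem_sup_right (self_mem_line y)
    refine ⟨x, y, hl, hx1, hy1, h0, h1, ?_, ?_⟩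
    · rw [← neg_inj, ← inner_J₂_left, ← inner_kahlerMap_left x hy, hAx, inner_smul_left,
        real_inner_self_eq_norm_sq, hy1]
      simp
    · rw [← neg_eq_zero, ← inner_J₃_left, ← neg_eq_zero, ← inner_neg_left, ← J₂_J₁,
        ← inner_kahlerMap_left _ hy, kahlerMap_J₁ hW, hAx, map_smul, inner_neg_left,
        inner_smul_left, real_inner_comm, inner_J₁_self]
      simp
  obtain ⟨x, y, hl, hx, hy, h0, h1, h2, h3⟩ := key hW hd h
  obtain ⟨x', y', hl', hx', hy', h0', h1', h2', h3'⟩ := key hW' hd' h'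
  have hxx : H.SameGram (x, x') (x, x') := sameGram_self_iff.2 (by rw [hx, hx'])
  have hyy : H.SameGram (y, y') (y, y') := sameGram_self_iff.2 (by rw [hy, hy'])
  have hxy : H.SameGram (x, x') (y, y') :=
    ⟨by rw [h0, h0'], by rw [h1, h1'], by rw [h2, h2'], by rw [h3, h3']⟩
  obtain ⟨g, hg, hgx⟩ := exists_mem_Sp_of_sameGram (H := H) ![x, y] ![x', y'] (by
    intro a b
    fin_cases a <;> fin_cases b
    exacts [hxx, hxy, hxy.symm, hyy])
  have e0 : g x = x' := hgx 0
  have e1 : g y = y' := hgx 1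
  exact ⟨g, hg, by rw [hl, Submodule.map_sup, map_line hg, map_line hg, e0, e1, hl']⟩

lemma eq_line_of_finrank {C : Submodule ℝ V} (hC : IsComplex H.J₁ C) (hd : finrank ℝ C ≤ 2)
    {x : V} (hx : x ∈ C) (hx0 : x ≠ 0) : C = H.line x := by
  symm
  apply Submodule.eq_of_le_of_finrank_le (line_le hC hx)
  rwa [finrank_line hx0]

/-- Such a subspace is zero or the complex line of a unit vector, and Sp(n) is transitive on unit
vectors. -/
lemma exists_mem_Sp_map_line {C C' : Submodule ℝ V} (hC : IsComplex H.J₁ C)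
    (hC' : IsComplex H.J₁ C') (hd : finrank ℝ C ≤ 2) (he : finrank ℝ C = finrank ℝ C') :
    ∃ g ∈ H.Sp, C.map (g.toLinearEquiv : V →ₗ[ℝ] V) = C' := by
  by_cases h0 : C = ⊥
  · refine ⟨1, H.Sp.one_mem, ?_⟩
    rw [h0, finrank_bot, eq_comm, Submodule.finrank_eq_zero] at he
    rw [h0, he, Submodule.map_bot]
  · have h0' : C' ≠ ⊥ := by
      rintro rfl
      rw [finrank_bot, Submodule.finrank_eq_zero] at he
      exact h0 he
    obtain ⟨x, hx, hx1⟩ := exists_unit_mem h0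
    obtain ⟨x', hx', hx1'⟩ := exists_unit_mem h0'
    obtain ⟨g, hg, hgx⟩ := exists_mem_Sp_of_sameGram (H := H) (fun _ : Unit => x) (fun _ => x')
      fun _ _ => sameGram_self_iff.2 (by rw [hx1, hx1'])
    refine ⟨g, hg, ?_⟩
    rw [eq_line_of_finrank hC hd hx (norm_ne_zero_iff.1 (by rw [hx1]; exact one_ne_zero)),
      eq_line_of_finrank hC' (he ▸ hd) hx' (norm_ne_zero_iff.1 (by rw [hx1']; exact one_ne_zero)),
      map_line hg, hgx ()]

namespace IsBlockDecomposition

variable {P P' : Submodule ℝ V} {k : ℕ} {B B' : Fin k → Submodule ℝ V} {φ φ' : Fin k → ℝ}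
  {C C' : Submodule ℝ V}

/-- The index `none` stands for the remainder `C`, so that it is treated like a block; below, its
angle is π/2. -/
lemma ortho_option (h : H.IsBlockDecomposition P B φ C) (i j : Option (Fin k)) (hij : i ≠ j) :
    H.HermitianOrtho (i.elim C B) (j.elim C B) := by
  cases i <;> cases j
  · exact absurd rfl hij
  · exact (h.ortho_rest _).symm
  · exact h.ortho_rest _
  · exact h.ortho _ _ fun e => hij (by rw [e])

lemma iSup_option (h : H.IsBlockDecomposition P B φ C) :
    ⨆ i : Option (Fin k), i.elim C B = P := by
  rw [_root_.iSup_option, sup_comm]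
  exact h.sup_eq

lemma finrank_eq (h : H.IsBlockDecomposition P B φ C) : finrank ℝ P = 4 * k + finrank ℝ C := by
  rw [← h.iSup_option, finrank_iSup_of_isOrtho fun i j hij => (h.ortho_option i j hij).isOrtho,
    Fintype.sum_option]
  change finrank ℝ C + ∑ j, finrank ℝ (B j) = _
  rw [Finset.sum_congr rfl fun j _ => h.finrank_block j, Finset.sum_const, Finset.card_univ,
    Fintype.card_fin, smul_eq_mul, add_comm, mul_comm]

lemma finrank_rest_le (h : H.IsBlockDecomposition P B φ C) : finrank ℝ C ≤ 2 := by
  rcases h.finrank_rest with h | h <;> omega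

lemma exists_mem_Sp (h : H.IsBlockDecomposition P B φ C)
    (h' : H.IsBlockDecomposition P' B' φ C') (hC : finrank ℝ C = finrank ℝ C') :
    ∃ g ∈ H.Sp, P.map (g.toLinearEquiv : V →ₗ[ℝ] V) = P' := by
  obtain ⟨g, hg, hgB⟩ := exists_mem_Sp_map_eq h.ortho_option h'.ortho_option (by
    rintro (_ | j)
    · exact exists_mem_Sp_map_line h.complex_rest h'.complex_rest h.finrank_rest_le hC
    · exact exists_mem_Sp_map_block (h.complex_block j) (h.finrank_block j) (h.angle j)
        (h'.complex_block j) (h'.finrank_block j) (h'.angle j))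
  exact ⟨g, hg, by rw [← h.iSup_option, ← h'.iSup_option, Submodule.map_iSup]; simp only [hgB]⟩

/-- On a block this is read off from the normal form. On the remainder the map itself vanishes, as
J₂x is orthogonal to x and J₁x. -/
lemma kahlerMap_sq_block (h : H.IsBlockDecomposition P B φ C) (i : Option (Fin k)) {x : V}
    (hx : x ∈ (i.elim C B : Submodule ℝ V)) :
    H.kahlerMap (i.elim C B) (H.kahlerMap (i.elim C B) x) =
      -Real.cos (i.elim (Real.pi / 2) φ) ^ 2 • x := by
  cases i with
  | none =>
    simp only [Option.elim_none, Real.cos_pi_div_two] at hx ⊢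
    suffices h0 : H.kahlerMap C x = 0 by simp [h0]
    rcases eq_or_ne x 0 with rfl | hx0
    · simp
    have hm := kahlerMap_mem (H := H) C x
    rw [← inner_self_eq_zero (𝕜 := ℝ), inner_kahlerMap_left x hm]
    generalize H.kahlerMap C x = z at hm
    rw [eq_line_of_finrank h.complex_rest h.finrank_rest_le hx hx0, mem_line] at hm
    obtain ⟨a, b, rfl⟩ := hm
    simp [inner_add_right, inner_smul_right, inner_J₂_left, inner_J₂_self, inner_J₃_self]
  | some j =>
    simp only [Option.elim_some] at hx ⊢
    obtain ⟨u, v, hu, hv, h0, h1, hAu, hAv, hl⟩ :=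
      (h.angle j).exists_normal (h.complex_block j) (h.finrank_block j)
    have hx' := hx
    rw [hl] at hx'
    obtain ⟨y, hy, z, hz, rfl⟩ := Submodule.mem_sup.1 hx'
    obtain ⟨a, b, rfl⟩ := mem_line.1 hy
    obtain ⟨a', b', rfl⟩ := mem_line.1 hz
    simp only [map_add, map_smul, kahlerMap_J₁ (h.complex_block j), map_neg, hAu, hAv]
    module

/-- J₂ maps an addend into the orthogonal complement of the other addends. -/
lemma kahlerMap_eq (h : H.IsBlockDecomposition P B φ C) (i : Option (Fin k)) {x : V}
    (hx : x ∈ (i.elim C B : Submodule ℝ V)) :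
    H.kahlerMap P x = H.kahlerMap (i.elim C B) x := by
  set D : Option (Fin k) → Submodule ℝ V := fun i => i.elim C B with hD
  have hm := kahlerMap_mem (H := H) (D i) x
  change x ∈ D i at hx
  change H.kahlerMap P x = H.kahlerMap (D i) x
  have hP : P = ⨆ i, D i := h.iSup_option.symm
  rw [kahlerMap_apply]
  apply Submodule.eq_starProjection_of_mem_of_inner_eq_zero
  · rw [hP]; exact le_iSup D i hm
  · suffices hle : P ≤ (Submodule.span ℝ {H.J₂ x - H.kahlerMap (D i) x})ᗮ from
      fun w hw => hle hw _ (Submodule.mem_span_singleton_self _)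
    rw [hP, iSup_le_iff]
    intro j p hp
    rw [Submodule.mem_orthogonal_singleton_iff_inner_right, inner_sub_left]
    by_cases e : i = j
    · subst e
      rw [inner_kahlerMap_left x hp, sub_self]
    · have ho := hermitianOrtho_iff.1 (h.ortho_option i j e)
      rw [inner_J₂_left, (ho x hx p hp).2.2.1, (ho _ hm p hp).1]
      simp

lemma kahlerMap_sq (h : H.IsBlockDecomposition P B φ C) (i : Option (Fin k)) {x : V}
    (hx : x ∈ (i.elim C B : Submodule ℝ V)) : H.kahlerMap P (H.kahlerMap P x) =
      -Real.cos (i.elim (Real.pi / 2) φ) ^ 2 • x := by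
  rw [h.kahlerMap_eq i hx, h.kahlerMap_eq i (kahlerMap_mem _ _), h.kahlerMap_sq_block i hx]

lemma angle_mem (h : H.IsBlockDecomposition P B φ C) (i : Option (Fin k)) :
    0 ≤ i.elim (Real.pi / 2) φ ∧ i.elim (Real.pi / 2) φ ≤ Real.pi / 2 := by
  cases i with
  | none => exact ⟨Real.pi_div_two_pos.le, le_rfl⟩
  | some j =>
    have := (isKahlerAngle_iff (h.complex_block j)).1 (h.angle j)
    exact ⟨this.1, this.2.1⟩

end IsBlockDecomposition

variable (H) in
/-- The vectors of `P` on which the square of `kahlerMap P` is `-cos² t`. -/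
noncomputable def kahlerEigenspace (P : Submodule ℝ V) (t : ℝ) : Submodule ℝ V :=
  P ⊓ LinearMap.ker (H.kahlerMap P ∘ₗ H.kahlerMap P + Real.cos t ^ 2 • LinearMap.id)

lemma mem_kahlerEigenspace {P : Submodule ℝ V} {t : ℝ} {x : V} :
    x ∈ H.kahlerEigenspace P t ↔
      x ∈ P ∧ H.kahlerMap P (H.kahlerMap P x) = -Real.cos t ^ 2 • x := by
  simp [kahlerEigenspace, add_eq_zero_iff_eq_neg]

namespace IsBlockDecomposition

variable {P P' : Submodule ℝ V} {k : ℕ} {B B' : Fin k → Submodule ℝ V} {φ φ' : Fin k → ℝ}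
  {C C' : Submodule ℝ V}

lemma kahlerEigenspace_eq (h : H.IsBlockDecomposition P B φ C) {t : ℝ} (ht0 : 0 ≤ t)
    (ht1 : t ≤ Real.pi / 2) : H.kahlerEigenspace P t =
      ⨆ i : Option (Fin k), if i.elim (Real.pi / 2) φ = t then i.elim C B else ⊥ := by
  have hDP (i : Option (Fin k)) : i.elim C B ≤ P :=
    (le_iSup (fun i : Option (Fin k) => i.elim C B) i).trans h.iSup_option.le
  apply le_antisymm
  · intro x hx
    obtain ⟨hxP, hx2⟩ := mem_kahlerEigenspace.1 hx
    rw [← h.iSup_option] at hxP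
    obtain ⟨f, hf, rfl⟩ := exists_sum_of_mem_iSup hxP
    -- Comparing the components of the eigenvalue equation, each component vanishes unless its
    -- squared cosine is cos² t, which on [0, π/2] forces its angle to be t.
    have hz := eq_zero_of_sum_eq_zero (fun i j hij => (h.ortho_option i j hij).isOrtho)
      (f := fun i => (Real.cos t ^ 2 - Real.cos (i.elim (Real.pi / 2) φ) ^ 2) • f i)
      (fun i => Submodule.smul_mem _ _ (hf i)) (by
        rw [map_sum, map_sum, Finset.smul_sum, ← sub_eq_zero, ← Finset.sum_sub_distrib] at hx2
        rw [← hx2]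
        refine Finset.sum_congr rfl fun i _ => ?_
        rw [h.kahlerMap_sq i (hf i)]
        module)
    refine Submodule.sum_mem _ fun i _ => ?_
    rcases smul_eq_zero.1 (hz i) with h1 | h1
    · have hi := h.angle_mem i
      have hpi := Real.pi_pos
      have hcos : Real.cos t = Real.cos (i.elim (Real.pi / 2) φ) :=
        (sq_eq_sq₀ (Real.cos_nonneg_of_mem_Icc ⟨by linarith, ht1⟩)
          (Real.cos_nonneg_of_mem_Icc ⟨by linarith, hi.2⟩)).1 (sub_eq_zero.1 h1)
      have hti := Real.injOn_cos ⟨ht0, by linarith⟩ ⟨hi.1, by linarith⟩ hcos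
      refine Submodule.mem_iSup_of_mem i ?_
      rw [if_pos hti.symm]
      exact hf i
    · rw [h1]; exact Submodule.zero_mem _
  · refine iSup_le fun i => ?_
    split_ifs with hi
    · intro x hx
      rw [mem_kahlerEigenspace, ← hi]
      exact ⟨hDP i hx, h.kahlerMap_sq i hx⟩
    · exact bot_le

/-- The left side does not involve the decomposition, so the number of blocks with a given angle is
an invariant of `P`. -/
lemma finrank_kahlerEigenspace (h : H.IsBlockDecomposition P B φ C) {t : ℝ} (ht0 : 0 ≤ t)
    (ht1 : t ≤ Real.pi / 2) : finrank ℝ (H.kahlerEigenspace P t) =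
      4 * Fintype.card {j // φ j = t} + if t = Real.pi / 2 then finrank ℝ C else 0 := by
  classical
  rw [h.kahlerEigenspace_eq ht0 ht1, finrank_iSup_of_isOrtho]
  · have e (i : Option (Fin k)) :
        finrank ℝ ↥(if i.elim (Real.pi / 2) φ = t then i.elim C B else ⊥) =
          if i.elim (Real.pi / 2) φ = t then finrank ℝ ↥(i.elim C B) else 0 := by
      by_cases hi : i.elim (Real.pi / 2) φ = t
      · rw [if_pos hi, if_pos hi]
      · rw [if_neg hi, if_neg hi, finrank_bot]
    rw [Finset.sum_congr rfl fun i _ => e i, Fintype.sum_option]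
    change (if Real.pi / 2 = t then finrank ℝ C else 0) +
      (∑ j, if φ j = t then finrank ℝ (B j) else 0) = _
    rw [Finset.sum_congr rfl fun j _ => congrArg (if φ j = t then · else 0) (h.finrank_block j),
      ← Finset.sum_filter, Finset.sum_const, Fintype.card_subtype, add_comm, smul_eq_mul, mul_comm]
    simp only [eq_comm]
  · intro i j hij
    have := (h.ortho_option i j hij).isOrtho
    split_ifs <;> simp [this]

lemma angles_unique (h : H.IsBlockDecomposition P B φ C) (h' : H.IsBlockDecomposition P B' φ' C')
    (hφ : Monotone φ) (hφ' : Monotone φ') : φ = φ' := by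
  have hC : finrank ℝ C = finrank ℝ C' := by
    have := h.finrank_eq
    have := h'.finrank_eq
    omega
  have hcard (t : ℝ) : Fintype.card {j // φ j = t} = Fintype.card {j // φ' j = t} := by
    by_cases ht : 0 ≤ t ∧ t ≤ Real.pi / 2
    · have h1 := h.finrank_kahlerEigenspace ht.1 ht.2
      have h2 := h'.finrank_kahlerEigenspace ht.1 ht.2
      rw [hC] at h1
      omega
    · have : IsEmpty {j // φ j = t} := ⟨fun j => ht (j.2 ▸ h.angle_mem (some j.1))⟩
      have : IsEmpty {j // φ' j = t} := ⟨fun j => ht (j.2 ▸ h'.angle_mem (some j.1))⟩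
      rw [Fintype.card_eq_zero, Fintype.card_eq_zero]
  -- Equal fibre cardinalities make the angle tuples permutations of each other; monotone ones then
  -- coincide.
  let σ : Equiv.Perm (Fin k) := Equiv.ofFiberEquiv fun t => Fintype.equivOfCardEq (hcard t)
  have hσ : φ' ∘ σ = φ := funext fun j => Equiv.ofFiberEquiv_map _ j
  have := Tuple.unique_monotone (f := φ') (σ := σ) (τ := 1) (by rwa [hσ]) (by simpa using hφ')
  rw [hσ] at this
  simpa using this

end IsBlockDecomposition

end Conjugacy
end HermitianHypercomplex

namespace HermitianHypercomplex

/-! ### Kähler multipleangles: existence, uniqueness, completeness, invariance. -/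

section Transport

variable {V : Type*} [NormedAddCommGroup V] [InnerProductSpace ℝ V]
  {H : HermitianHypercomplex V}

lemma apply_mem_map (g : V ≃ₗᵢ[ℝ] V) {U : Submodule ℝ V} {x : V} (hx : x ∈ U) :
    g x ∈ U.map (g.toLinearEquiv : V →ₗ[ℝ] V) :=
  Submodule.mem_map_of_mem (f := (g.toLinearEquiv : V →ₗ[ℝ] V)) hx

lemma HermitianOrtho.map {g : V ≃ₗᵢ[ℝ] V} (hg : g ∈ H.Sp) {A B : Submodule ℝ V}
    (h : H.HermitianOrtho A B) : H.HermitianOrtho (A.map (g.toLinearEquiv : V →ₗ[ℝ] V))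
      (B.map (g.toLinearEquiv : V →ₗ[ℝ] V)) := by
  rw [hermitianOrtho_iff] at h ⊢
  rintro _ ⟨a, ha, rfl⟩ _ ⟨b, hb, rfl⟩
  obtain ⟨h0, h1, h2, h3⟩ := sameGram_apply hg a b
  obtain ⟨k0, k1, k2, k3⟩ := h a ha b hb
  exact ⟨h0.symm.trans k0, h1.symm.trans k1, h2.symm.trans k2, h3.symm.trans k3⟩

lemma finrank_map (g : V ≃ₗᵢ[ℝ] V) (U : Submodule ℝ V) :
    finrank ℝ (U.map (g.toLinearEquiv : V →ₗ[ℝ] V)) = finrank ℝ U :=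
  finrank_map_of_injective g.injective U

lemma hermitianOrtho_bot (A : Submodule ℝ V) : H.HermitianOrtho A ⊥ := by
  rw [hermitianOrtho_iff]
  rintro a - b hb
  rw [Submodule.mem_bot] at hb
  simp [hb]

lemma IsComplex.map {g : V ≃ₗᵢ[ℝ] V} (hg : g ∈ H.Sp) {A : End ℝ V} (hA : A ∈ H.sphere)
    {U : Submodule ℝ V} (hU : IsComplex A U) :
    IsComplex A (U.map (g.toLinearEquiv : V →ₗ[ℝ] V)) := by
  rw [isComplex_iff hA] at hU ⊢
  rintro _ ⟨x, hx, rfl⟩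
  change A (g x) ∈ _
  rw [← Sp_apply_sphere hg hA]
  exact apply_mem_map g (hU x hx)

variable [FiniteDimensional ℝ V]

lemma kahlerMap_map {g : V ≃ₗᵢ[ℝ] V} (hg : g ∈ H.Sp) (U : Submodule ℝ V) (x : V) :
    H.kahlerMap (U.map (g.toLinearEquiv : V →ₗ[ℝ] V)) (g x) = g (H.kahlerMap U x) := by
  rw [kahlerMap_apply, Submodule.starProjection_map_apply, ← Sp_apply_sphere hg H.J₂_mem_sphere,
    g.symm_apply_apply, kahlerMap_apply]

lemma IsBlockDecomposition.map {g : V ≃ₗᵢ[ℝ] V} (hg : g ∈ H.Sp) {P : Submodule ℝ V} {k : ℕ}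
    {B : Fin k → Submodule ℝ V} {φ : Fin k → ℝ} {C : Submodule ℝ V}
    (h : H.IsBlockDecomposition P B φ C) :
    H.IsBlockDecomposition (P.map (g.toLinearEquiv : V →ₗ[ℝ] V))
      (fun j => (B j).map (g.toLinearEquiv : V →ₗ[ℝ] V)) φ
      (C.map (g.toLinearEquiv : V →ₗ[ℝ] V)) where
  finrank_block j := by rw [finrank_map, h.finrank_block]
  complex_block j := (h.complex_block j).map hg H.J₁_mem_sphere
  angle j := by
    have := (isKahlerAngle_iff (h.complex_block j)).1 (h.angle j)
    rw [isKahlerAngle_iff ((h.complex_block j).map hg H.J₁_mem_sphere)]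
    refine ⟨this.1, this.2.1, ?_⟩
    rintro _ ⟨x, hx, rfl⟩
    change ‖H.kahlerMap _ (g x)‖ = _ * ‖g x‖
    rw [kahlerMap_map hg, g.norm_map, g.norm_map, this.2.2 x hx]
  ortho j l hjl := (h.ortho j l hjl).map hg
  ortho_rest j := (h.ortho_rest j).map hg
  complex_rest := h.complex_rest.map hg H.J₁_mem_sphere
  finrank_rest := by rw [finrank_map]; exact h.finrank_rest
  sup_eq := by rw [← Submodule.map_iSup, ← Submodule.map_sup, h.sup_eq]

lemma IsBlockDecomposition.comp_equiv {P : Submodule ℝ V} {k : ℕ}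
    {B : Fin k → Submodule ℝ V} {φ : Fin k → ℝ} {C : Submodule ℝ V}
    (h : H.IsBlockDecomposition P B φ C) (σ : Equiv.Perm (Fin k)) :
    H.IsBlockDecomposition P (B ∘ σ) (φ ∘ σ) C where
  finrank_block j := h.finrank_block _
  complex_block j := h.complex_block _
  angle j := h.angle _
  ortho j l hjl := h.ortho _ _ (σ.injective.ne hjl)
  ortho_rest j := h.ortho_rest _
  complex_rest := h.complex_rest
  finrank_rest := h.finrank_rest
  sup_eq := by rw [← h.sup_eq]; congr 1; exact σ.iSup_comp (g := B)

/-- The even and odd cases merge by taking `C = ⊥` in the even one. -/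
lemma isKahlerMultipleangle_J₁_iff {P : Submodule ℝ V} {m : ℕ} {θ : List ℝ} :
    H.IsKahlerMultipleangle H.J₁ P m θ ↔
      ∃ (k : ℕ) (B : Fin k → Submodule ℝ V) (φ : Fin k → ℝ) (C : Submodule ℝ V),
        H.IsBlockDecomposition P B φ C ∧ Monotone φ ∧ 2 * m = 4 * k + finrank ℝ C ∧
          θ = List.ofFn φ ++ if finrank ℝ C = 0 then [] else [Real.pi / 2] := by
  constructor
  · rintro ⟨hm, k, B, φ, hB, ho, hφ, ⟨rfl, hs, rfl⟩ | ⟨rfl, C, hC2, hC, hBC, hs, rfl⟩⟩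
    · refine ⟨k, B, φ, ⊥, ⟨fun j => (hB j).1, fun j => (hB j).2.1, fun j => (hB j).2.2, ho,
        fun j => hermitianOrtho_bot _, Submodule.map_bot _, Or.inl (finrank_bot ℝ V), ?_⟩, hφ, ?_,
        ?_⟩
      · rw [hs, sup_bot_eq]
      · rw [finrank_bot]; omega
      · simp
    · refine ⟨k, B, φ, C, ⟨fun j => (hB j).1, fun j => (hB j).2.1, fun j => (hB j).2.2, ho,
        hBC, hC, Or.inr hC2, hs⟩, hφ, ?_, ?_⟩
      · omega
      · simp [hC2]
  · rintro ⟨k, B, φ, C, hB, hφ, hm, rfl⟩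
    refine ⟨by rw [hB.finrank_eq, hm], k, B, φ,
      fun j => ⟨hB.finrank_block j, hB.complex_block j, hB.angle j⟩, hB.ortho, hφ, ?_⟩
    rcases hB.finrank_rest with h0 | h2
    · left
      have hs := hB.sup_eq
      rw [Submodule.finrank_eq_zero.1 h0, sup_bot_eq] at hs
      exact ⟨by omega, hs, by simp [h0]⟩
    · right
      exact ⟨by omega, C, h2, hB.complex_rest, hB.ortho_rest, hB.sup_eq, by simp [h2]⟩

/-- Every complex subspace has a Kähler multipleangle. -/
theorem exists_isKahlerMultipleangle {I : End ℝ V} (hI : I ∈ H.sphere) {P : Submodule ℝ V}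
    (hP : IsComplex I P) : ∃ m θ, H.IsKahlerMultipleangle I P m θ := by
  obtain ⟨H', rfl, hs⟩ := exists_rebase hI
  obtain ⟨k, B, φ, C, h⟩ := exists_isBlockDecomposition hP
  have hr := h.finrank_rest
  refine ⟨2 * k + finrank ℝ C / 2, _, (isKahlerMultipleangle_congr hs).1
    (isKahlerMultipleangle_J₁_iff.2 ⟨k, _, _, C, h.comp_equiv (Tuple.sort φ),
      Tuple.monotone_sort φ, by omega, rfl⟩)⟩

/-- The Kähler multipleangle is unique. -/
theorem IsKahlerMultipleangle.unique {I : End ℝ V} (hI : I ∈ H.sphere) {P : Submodule ℝ V}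
    {m m' : ℕ} {θ θ' : List ℝ} (h : H.IsKahlerMultipleangle I P m θ)
    (h' : H.IsKahlerMultipleangle I P m' θ') : m = m' ∧ θ = θ' := by
  obtain ⟨H', rfl, hs⟩ := exists_rebase hI
  rw [← isKahlerMultipleangle_congr hs, isKahlerMultipleangle_J₁_iff] at h h'
  obtain ⟨k, B, φ, C, hB, hφ, hm, rfl⟩ := h
  obtain ⟨k', B', φ', C', hB', hφ', hm', rfl⟩ := h'
  have e := hB.finrank_eq
  have e' := hB'.finrank_eq
  have hr := hB.finrank_rest
  have hr' := hB'.finrank_rest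
  -- As dim C is 0 or 2, the dimension of P determines k.
  have hk : k = k' := by omega
  subst hk
  have hC : finrank ℝ C = finrank ℝ C' := by omega
  exact ⟨by omega, by rw [hB.angles_unique hB' hφ hφ', hC]⟩

/-- Complex subspaces with the same Kähler multipleangle are related by an element of `Sp(n)`. -/
theorem IsKahlerMultipleangle.exists_mem_Sp {I : End ℝ V} (hI : I ∈ H.sphere)
    {P P' : Submodule ℝ V} {m : ℕ} {θ : List ℝ} (h : H.IsKahlerMultipleangle I P m θ)
    (h' : H.IsKahlerMultipleangle I P' m θ) :
    ∃ g ∈ H.Sp, P.map (g.toLinearEquiv : V →ₗ[ℝ] V) = P' := by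
  obtain ⟨H', rfl, hs⟩ := exists_rebase hI
  rw [← isKahlerMultipleangle_congr hs, isKahlerMultipleangle_J₁_iff] at h h'
  rw [← Sp_congr hs]
  obtain ⟨k, B, φ, C, hB, hφ, hm, rfl⟩ := h
  obtain ⟨k', B', φ', C', hB', hφ', hm', hθ⟩ := h'
  have hr := hB.finrank_rest
  have hr' := hB'.finrank_rest
  have hk : k = k' := by omega
  subst hk
  have hC : finrank ℝ C = finrank ℝ C' := by omega
  rw [hC] at hθ
  have := List.ofFn_injective (List.append_cancel_right hθ)
  subst this
  exact hB.exists_mem_Sp hB' hC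

theorem IsKahlerMultipleangle.map {I : End ℝ V} (hI : I ∈ H.sphere) {g : V ≃ₗᵢ[ℝ] V}
    (hg : g ∈ H.Sp) {P : Submodule ℝ V} {m : ℕ} {θ : List ℝ}
    (h : H.IsKahlerMultipleangle I P m θ) :
    H.IsKahlerMultipleangle I (P.map (g.toLinearEquiv : V →ₗ[ℝ] V)) m θ := by
  obtain ⟨H', rfl, hs⟩ := exists_rebase hI
  rw [← isKahlerMultipleangle_congr hs, isKahlerMultipleangle_J₁_iff] at h ⊢
  rw [← Sp_congr hs] at hg
  obtain ⟨k, B, φ, C, hB, hφ, hm, rfl⟩ := h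
  exact ⟨k, _, φ, _, hB.map hg, hφ, by rw [finrank_map, hm], by rw [finrank_map]⟩

end Transport

/-! ### Orthogonality and purity in Σ-decompositions. -/

section SigmaDecompositions

variable {V : Type*} [NormedAddCommGroup V] [InnerProductSpace ℝ V]
  {H : HermitianHypercomplex V}

lemma mem_of_combination_mem {S : Submodule ℝ V} {u v : V} {b c : ℝ} (hbc : b ^ 2 + c ^ 2 ≠ 0)
    (h1 : b • u + c • v ∈ S) (h2 : b • v - c • u ∈ S) : u ∈ S ∧ v ∈ S := by
  constructor
  · have : u = (b ^ 2 + c ^ 2)⁻¹ • (b • (b • u + c • v) - c • (b • v - c • u)) := by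
      rw [show b • (b • u + c • v) - c • (b • v - c • u) = (b ^ 2 + c ^ 2) • u by module,
        inv_smul_smul₀ hbc]
    rw [this]
    exact S.smul_mem _ (S.sub_mem (S.smul_mem _ h1) (S.smul_mem _ h2))
  · have : v = (b ^ 2 + c ^ 2)⁻¹ • (c • (b • u + c • v) + b • (b • v - c • u)) := by
      rw [show c • (b • u + c • v) + b • (b • v - c • u) = (b ^ 2 + c ^ 2) • v by module,
        inv_smul_smul₀ hbc]
    rw [this]
    exact S.smul_mem _ (S.add_mem (S.smul_mem _ h1) (S.smul_mem _ h2))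

lemma coeff_ne_zero_of_ne {a b c : ℝ} (h : a ^ 2 + b ^ 2 + c ^ 2 = 1)
    (h1 : H.J₁ ≠ H.comb a b c) (h2 : H.J₁ ≠ -H.comb a b c) : b ^ 2 + c ^ 2 ≠ 0 := by
  intro h0
  have hb : b = 0 := by nlinarith [sq_nonneg b, sq_nonneg c]
  have hc : c = 0 := by nlinarith [sq_nonneg b, sq_nonneg c]
  subst hb hc
  have ha : a * a = 1 := by linarith
  rcases mul_self_eq_one_iff.1 ha with rfl | rfl
  · exact h1 (by simp [comb])
  · exact h2 (by simp [comb])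

/-- If an orthogonal subspace is preserved by `J₁` and the other one by another structure which
is not `±J₁`, the subspaces are Hermitian orthogonal. -/
lemma hermitianOrtho_of_isComplex {I I' : End ℝ V} (hI : I ∈ H.sphere) (hI' : I' ∈ H.sphere)
    (hne : I ≠ I') (hne' : I ≠ -I') {P P' : Submodule ℝ V} (hP : IsComplex I P)
    (hP' : IsComplex I' P') (ho : P ⟂ P') : H.HermitianOrtho P P' := by
  rw [isComplex_iff hI] at hP
  rw [isComplex_iff hI'] at hP'
  rw [Submodule.isOrtho_iff_inner_eq] at ho
  obtain ⟨K, rfl, hs⟩ := exists_rebase hI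
  rw [← hermitianOrtho_congr hs, hermitianOrtho_iff]
  rw [← hs] at hI'
  obtain ⟨a, b, c, h, rfl⟩ := hI'
  have hbc := coeff_ne_zero_of_ne h hne hne'
  intro u hu v hv
  have o1 (u) (hu : u ∈ P) : inner ℝ u (K.J₁ v) = 0 := by
    rw [← neg_eq_zero, ← inner_J₁_left]; exact ho _ (hP u hu) v hv
  have o2 (u) (hu : u ∈ P) : b * inner ℝ u (K.J₂ v) + c * inner ℝ u (K.J₃ v) = 0 := by
    have := ho u hu _ (hP' v hv)
    rw [inner_comb_right, o1 u hu] at this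
    linarith
  -- The relation at u and at J₁u is a linear system in ⟨u, J₂v⟩ and ⟨u, J₃v⟩ with determinant ±(b²
  -- + c²) ≠ 0.
  have e2 := o2 u hu
  have e3 := o2 _ (hP u hu)
  rw [inner_J₁_left, inner_J₁_left, J₁_J₂, J₁_J₃, inner_neg_right] at e3
  refine ⟨ho u hu v hv, o1 u hu, ?_, ?_⟩
  · apply (mul_eq_zero.1 (_ : (b ^ 2 + c ^ 2) * _ = 0)).resolve_left hbc
    linear_combination b * e2 + c * e3
  · apply (mul_eq_zero.1 (_ : (b ^ 2 + c ^ 2) * _ = 0)).resolve_left hbc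
    linear_combination c * e2 - b * e3

/-- The vectors with this property form a quaternionic subspace of `U`. -/
lemma IsPure.eq_zero {U : Submodule ℝ V} (hU : H.IsPure U) {x : V} (h0 : x ∈ U)
    (h1 : H.J₁ x ∈ U) (h2 : H.J₂ x ∈ U) (h3 : H.J₃ x ∈ U) : x = 0 := by
  let Q : Submodule ℝ V := U ⊓ U.comap H.J₁ ⊓ U.comap H.J₂ ⊓ U.comap H.J₃
  have hQ (y : V) : y ∈ Q ↔ ((y ∈ U ∧ H.J₁ y ∈ U) ∧ H.J₂ y ∈ U) ∧ H.J₃ y ∈ U := Iff.rfl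
  have hb : Q = ⊥ := by
    refine hU Q (fun y hy => ((hQ y).1 hy).1.1.1) fun A hA => (isComplex_iff hA).2 fun y hy => ?_
    obtain ⟨⟨⟨hy0, hy1⟩, hy2⟩, hy3⟩ := (hQ y).1 hy
    obtain ⟨a, b, c, -, rfl⟩ := hA
    rw [comb_apply]
    refine add_mem (add_mem ?_ ?_) ?_ <;> refine Submodule.smul_mem _ _ ((hQ _).2 ?_) <;>
      simp [*]
  have : x ∈ Q := ⟨⟨⟨h0, h1⟩, h2⟩, h3⟩
  rwa [hb, Submodule.mem_bot] at this

/-- With I = J₁ and I' = aJ₁ + bJ₂ + cJ₃, the vector bJ₂x + cJ₃x and its J₁-image lie in P. Solving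
for J₂x and J₃x puts all quaternionic multiples of x in U. -/
lemma IsPure.eq_zero_of_mem {U : Submodule ℝ V} (hU : H.IsPure U) {I I' : End ℝ V}
    (hI : I ∈ H.sphere) (hI' : I' ∈ H.sphere) (hne : I ≠ I') (hne' : I ≠ -I')
    {P : Submodule ℝ V} (hPU : P ≤ U) (hP : IsComplex I P) {x : V} (hx : x ∈ P)
    (hx' : I' x ∈ P) : x = 0 := by
  rw [isComplex_iff hI] at hP
  obtain ⟨K, rfl, hs⟩ := exists_rebase hI
  rw [← hs] at hI'
  obtain ⟨a, b, c, h, rfl⟩ := hI'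
  have hU' : K.IsPure U := by simpa only [IsPure, IsQuaternionic, hs] using hU
  have h1 : b • K.J₂ x + c • K.J₃ x ∈ P := by
    have := P.sub_mem hx' (P.smul_mem a (hP x hx))
    rw [comb_apply] at this
    convert this using 1
    module
  have h2 : b • K.J₃ x - c • K.J₂ x ∈ P := by
    have := hP _ h1
    rw [map_add, map_smul, map_smul, J₁_J₂, J₁_J₃] at this
    convert this using 1
    module
  obtain ⟨h3, h4⟩ := mem_of_combination_mem (coeff_ne_zero_of_ne h hne hne') h1 h2
  exact hU'.eq_zero (hPU hx) (hPU (hP x hx)) (hPU h3) (hPU h4)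

namespace IsSigmaDecomposition

variable {U : Submodule ℝ V} {s : ℕ} {I : Fin s → End ℝ V} {P : Fin s → Submodule ℝ V}

lemma isComplex (h : H.IsSigmaDecomposition U I P) (i : Fin s) : IsComplex (I i) (P i) :=
  (h.maximal i).prop.2

/-- Sums of complex subspaces are complex, so a maximal one is the largest. -/
lemma le_of_isComplex (h : H.IsSigmaDecomposition U I P) (i : Fin s) {W : Submodule ℝ V}
    (hWU : W ≤ U) (hW : IsComplex (I i) W) : W ≤ P i :=
  le_sup_right.trans ((h.maximal i).le_of_ge
    (y := P i ⊔ W) ⟨sup_le (h.maximal i).prop.1 hWU, (h.isComplex i).sup hW⟩ le_sup_left)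

lemma hermitianOrtho (h : H.IsSigmaDecomposition U I P) (i j : Fin s) (hij : i ≠ j) :
    H.HermitianOrtho (P i) (P j) :=
  hermitianOrtho_of_isComplex (h.mem_sphere i) (h.mem_sphere j) (h.distinct i j hij).1
    (h.distinct i j hij).2 (h.isComplex i) (h.isComplex j) (h.ortho i j hij)

/-- A pure subspace with a decomposition into complex addends contains complex subspaces only for
the structures of the addends. -/
lemma eq_or_eq_neg_of_isComplex (h : H.IsSigmaDecomposition U I P) (hU : H.IsPure U)
    {A : End ℝ V} (hA : A ∈ H.sphere) {W : Submodule ℝ V} (hWU : W ≤ U) (hW : IsComplex A W)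
    (hW0 : W ≠ ⊥) : ∃ i, I i = A ∨ I i = -A := by
  by_contra! hne
  obtain ⟨x, hx, hx0⟩ := Submodule.exists_mem_ne_zero_of_ne_bot hW0
  apply hx0
  have hxU := hWU hx
  have hAU := hWU ((isComplex_iff hA).1 hW x hx)
  rw [← h.iSup_eq] at hxU hAU
  obtain ⟨f, hf, rfl⟩ := exists_sum_of_mem_iSup hxU
  obtain ⟨y, hy, hyA⟩ := exists_sum_of_mem_iSup hAU
  have hle (i : Fin s) : P i ≤ H.quaternionification (P i) :=
    (le_sup_left.trans le_sup_left).trans le_sup_left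
  -- Both A(f i) and y i lie in the i-th of the mutually orthogonal quaternionifications and have
  -- equal sums. Hence A(f i) = y i lies in P i, and purity gives f i = 0.
  have hz := eq_zero_of_sum_eq_zero (D := fun i => H.quaternionification (P i))
    (fun i j hij => h.hermitianOrtho i j hij) (f := fun i => A (f i) - y i)
    (fun i => sub_mem (map_le_quaternionification hA _ (Submodule.mem_map_of_mem (hf i)))
      (hle i (hy i))) (by rw [Finset.sum_sub_distrib, hyA, map_sum, sub_self])
  refine Finset.sum_eq_zero fun i _ => ?_
  refine hU.eq_zero_of_mem (h.mem_sphere i) hA (hne i).1 (hne i).2 (h.maximal i).prop.1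
    (h.isComplex i) (hf i) ?_
  rw [sub_eq_zero.1 (hz i)]
  exact hy i

end IsSigmaDecomposition

end SigmaDecompositions
end HermitianHypercomplex

namespace HermitianHypercomplex

/-! ### The lexicographic order and the choice of sign. -/

section Lexicographic

variable {V : Type*} [NormedAddCommGroup V] [InnerProductSpace ℝ V]
  {H : HermitianHypercomplex V}

variable (H) in
/-- The coefficients of an element of the quaternionic structure, read off at the vector `e`. -/
def lexCoeff (e : V) (A : End ℝ V) : ℝ ×ₗ ℝ ×ₗ ℝ :=
  toLex (inner ℝ (H.J₁ e) (A e), toLex (inner ℝ (H.J₂ e) (A e), inner ℝ (H.J₃ e) (A e)))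

/-- J₁e, J₂e, J₃e are orthonormal. So coefficients are well defined once V ≠ 0; a nonzero addend
will supply e. -/
lemma lexCoeff_comb {e : V} (he : ‖e‖ = 1) (a b c : ℝ) :
    H.lexCoeff e (H.comb a b c) = toLex (a, toLex (b, c)) := by
  simp [lexCoeff, comb_apply, inner_add_right, inner_smul_right, inner_J₁_left, inner_J₂_left,
    inner_J₃_left, inner_J₁_self, inner_J₂_self, inner_J₃_self, he,
    norm_sphere H.J₁_mem_sphere, norm_sphere H.J₂_mem_sphere, norm_sphere H.J₃_mem_sphere]

lemma toLex_lt_iff {a b c a' b' c' : ℝ} :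
    (toLex (a, toLex (b, c)) : ℝ ×ₗ ℝ ×ₗ ℝ) < toLex (a', toLex (b', c')) ↔
      (a < a' ∨ (a = a' ∧ (b < b' ∨ (b = b' ∧ c < c')))) := by
  simp [Prod.Lex.toLex_lt_toLex]

lemma LexLT.lexCoeff_lt {e : V} (he : ‖e‖ = 1) {A B : End ℝ V} (h : H.LexLT A B) :
    H.lexCoeff e A < H.lexCoeff e B := by
  obtain ⟨a, b, c, a', b', c', rfl, rfl, h⟩ := h
  rw [lexCoeff_comb he, lexCoeff_comb he, toLex_lt_iff]
  exact h

lemma LexLT.not_neg {e : V} (he : ‖e‖ = 1) {A : End ℝ V} (h : H.LexLT 0 A) : ¬ H.LexLT 0 (-A) := by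
  intro h'
  obtain ⟨a, b, c, a', b', c', h0, rfl, -⟩ := id h
  have e0 : (0 : End ℝ V) = H.comb 0 0 0 := by simp [comb]
  have e1 : -H.comb a' b' c' = H.comb (-a') (-b') (-c') := by simp only [comb]; module
  have h1 := h.lexCoeff_lt he
  have h2 := h'.lexCoeff_lt he
  rw [e1, e0, lexCoeff_comb he, lexCoeff_comb he, toLex_lt_iff] at h2
  rw [e0, lexCoeff_comb he, lexCoeff_comb he, toLex_lt_iff] at h1
  rcases h1 with h1 | ⟨h1, h1 | ⟨h1', h1⟩⟩ <;> rcases h2 with h2 | ⟨h2, h2 | ⟨h2', h2⟩⟩ <;>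
    linarith

lemma exists_lexLT_zero {A : End ℝ V} (hA : A ∈ H.sphere) :
    ∃ A', (A' = A ∨ A' = -A) ∧ H.LexLT 0 A' := by
  obtain ⟨a, b, c, h, rfl⟩ := hA
  have e0 : (0 : End ℝ V) = H.comb 0 0 0 := by simp [comb]
  have e1 : -H.comb a b c = H.comb (-a) (-b) (-c) := by simp only [comb]; module
  by_cases hp : 0 < a ∨ (0 = a ∧ (0 < b ∨ (0 = b ∧ 0 < c)))
  · exact ⟨_, Or.inl rfl, 0, 0, 0, a, b, c, e0, rfl, hp⟩
  · refine ⟨_, Or.inr rfl, 0, 0, 0, -a, -b, -c, e0, e1, ?_⟩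
    rcases lt_trichotomy a 0 with ha | rfl | ha
    · left; linarith
    · right
      refine ⟨by simp, ?_⟩
      rcases lt_trichotomy b 0 with hb | rfl | hb
      · left; linarith
      · right
        refine ⟨by simp, ?_⟩
        rcases lt_trichotomy c 0 with hc | rfl | hc
        · linarith
        · norm_num at h
        · exact absurd (Or.inr ⟨rfl, Or.inr ⟨rfl, hc⟩⟩) hp
      · exact absurd (Or.inr ⟨rfl, Or.inl hb⟩) hp
    · exact absurd (Or.inl ha) hp

end Lexicographic

/-! ### The invariants (𝓘, Θ) and the main theorem. -/

section Invariants

variable {V : Type*} [NormedAddCommGroup V] [InnerProductSpace ℝ V]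
  {H : HermitianHypercomplex V}

lemma isComplex_neg {A : End ℝ V} {U : Submodule ℝ V} : IsComplex (-A) U ↔ IsComplex A U := by
  rw [IsComplex, IsComplex, Submodule.map_neg]

namespace IsSigmaDecomposition

variable {U : Submodule ℝ V} {s : ℕ} {I : Fin s → End ℝ V} {P : Fin s → Submodule ℝ V}

lemma change_signs (h : H.IsSigmaDecomposition U I P) {I' : Fin s → End ℝ V}
    (hI : ∀ i, I' i = I i ∨ I' i = -I i) : H.IsSigmaDecomposition U I' P where
  mem_sphere i := by
    rcases hI i with e | e <;> rw [e]
    exacts [h.mem_sphere i, H.neg_mem_sphere (h.mem_sphere i)]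
  distinct i j hij := by
    obtain ⟨h1, h2⟩ := h.distinct i j hij
    rcases hI i with e | e <;> rcases hI j with e' | e' <;> rw [e, e']
    · exact ⟨h1, h2⟩
    · exact ⟨h2, by rwa [neg_neg]⟩
    · exact ⟨fun k => h2 (by rw [← k, neg_neg]), fun k => h1 (neg_injective k)⟩
    · exact ⟨fun k => h1 (neg_injective k), fun k => h2 (neg_injective k)⟩
  ne_bot := h.ne_bot
  maximal i := by
    rcases hI i with e | e <;> rw [e]
    · exact h.maximal i
    · simpa only [isComplex_neg] using h.maximal i
  ortho := h.ortho
  iSup_eq := h.iSup_eq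

lemma comp_equiv (h : H.IsSigmaDecomposition U I P) (σ : Equiv.Perm (Fin s)) :
    H.IsSigmaDecomposition U (I ∘ σ) (P ∘ σ) where
  mem_sphere i := h.mem_sphere _
  distinct i j hij := h.distinct _ _ (σ.injective.ne hij)
  ne_bot i := h.ne_bot _
  maximal i := h.maximal _
  ortho i j hij := h.ortho _ _ (σ.injective.ne hij)
  iSup_eq := by rw [← h.iSup_eq]; exact σ.iSup_comp (g := P)

/-- Sign changes do not affect the complex subspaces. Sorting by coefficients is strict because the
structures are distinct. -/
lemma exists_ordered (h : H.IsSigmaDecomposition U I P) :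
    ∃ (I' : Fin s → End ℝ V) (P' : Fin s → Submodule ℝ V), H.IsSigmaDecomposition U I' P' ∧
      (∀ i, H.LexLT 0 (I' i)) ∧ ∀ i j, i < j → H.LexLT (I' i) (I' j) := by
  choose K hK hK0 using fun i => exists_lexLT_zero (h.mem_sphere i)
  have hd := h.change_signs hK
  choose a b c habc hKe using hd.mem_sphere
  let key : Fin s → ℝ ×ₗ ℝ ×ₗ ℝ := fun i => toLex (a i, toLex (b i, c i))
  have hinj : Function.Injective key := by
    intro i j hij
    by_contra hne
    have h1 : a i = a j ∧ b i = b j ∧ c i = c j := by simpa [key] using hij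
    exact (hd.distinct i j hne).1 (by rw [hKe i, hKe j, h1.1, h1.2.1, h1.2.2])
  have hmono : StrictMono (key ∘ Tuple.sort key) :=
    (Tuple.monotone_sort key).strictMono_of_injective (hinj.comp (Tuple.sort key).injective)
  refine ⟨_, _, hd.comp_equiv (Tuple.sort key), fun i => hK0 _, fun i j hij => ?_⟩
  exact ⟨_, _, _, _, _, _, hKe _, hKe _, toLex_lt_iff.1 (hmono hij)⟩

lemma exists_structure_eq (hU : H.IsPure U) (h : H.IsSigmaDecomposition U I P)
    (hpos : ∀ i, H.LexLT 0 (I i)) {t : ℕ} {I' : Fin t → End ℝ V} {P' : Fin t → Submodule ℝ V}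
    (h' : H.IsSigmaDecomposition U I' P') (hpos' : ∀ i, H.LexLT 0 (I' i)) (j : Fin t) :
    ∃ i, I i = I' j := by
  obtain ⟨e, -, he⟩ := exists_unit_mem (h'.ne_bot j)
  obtain ⟨i, hi | hi⟩ := h.eq_or_eq_neg_of_isComplex hU (h'.mem_sphere j) (h'.maximal j).prop.1
    (h'.isComplex j) (h'.ne_bot j)
  · exact ⟨i, hi⟩
  · exact absurd (hi ▸ hpos i) ((hpos' j).not_neg he)

lemma injective (h : H.IsSigmaDecomposition U I P) : Function.Injective I := fun i j e => by
  by_contra hij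
  exact (h.distinct i j hij).1 e

lemma card_le (hU : H.IsPure U) (h : H.IsSigmaDecomposition U I P)
    (hpos : ∀ i, H.LexLT 0 (I i)) {t : ℕ} {I' : Fin t → End ℝ V} {P' : Fin t → Submodule ℝ V}
    (h' : H.IsSigmaDecomposition U I' P') (hpos' : ∀ i, H.LexLT 0 (I' i)) : t ≤ s := by
  choose f hf using exists_structure_eq hU h hpos h' hpos'
  have hinj : Function.Injective f := fun i j e => h'.injective (by rw [← hf i, ← hf j, e])
  simpa using Fintype.card_le_of_injective f hinj

lemma unique (hU : H.IsPure U) (h : H.IsSigmaDecomposition U I P)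
    (hpos : ∀ i, H.LexLT 0 (I i)) (hlt : ∀ i j, i < j → H.LexLT (I i) (I j))
    {I' : Fin s → End ℝ V} {P' : Fin s → Submodule ℝ V}
    (h' : H.IsSigmaDecomposition U I' P') (hpos' : ∀ i, H.LexLT 0 (I' i))
    (hlt' : ∀ i j, i < j → H.LexLT (I' i) (I' j)) : I = I' ∧ P = P' := by
  have hI : I = I' := by
    rcases isEmpty_or_nonempty (Fin s) with hs | ⟨⟨i₀⟩⟩
    · exact Subsingleton.elim _ _
    obtain ⟨e, -, he⟩ := exists_unit_mem (h.ne_bot i₀)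
    have hm : StrictMono (H.lexCoeff e ∘ I) := fun i j hij => (hlt i j hij).lexCoeff_lt he
    have hm' : StrictMono (H.lexCoeff e ∘ I') := fun i j hij => (hlt' i j hij).lexCoeff_lt he
    have hr : Set.range I = Set.range I' := by
      apply Set.Subset.antisymm
      · rintro _ ⟨i, rfl⟩; exact exists_structure_eq hU h' hpos' h hpos i
      · rintro _ ⟨i, rfl⟩; exact exists_structure_eq hU h hpos h' hpos' i
    -- Strictly increasing sequences with the same range coincide; equality of ranges then carries
    -- this from the coefficients back to the structures.
    have hc : H.lexCoeff e ∘ I = H.lexCoeff e ∘ I' :=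
      (hm.range_inj hm').1 (by rw [Set.range_comp, Set.range_comp, hr])
    funext i
    obtain ⟨j, hj⟩ : I i ∈ Set.range I' := hr ▸ ⟨i, rfl⟩
    have hji : j = i := hm.injective ((congrFun hc j).trans (congrArg (H.lexCoeff e) hj))
    rw [← hj, hji]
  subst hI
  exact ⟨rfl, funext fun i => le_antisymm
    (h'.le_of_isComplex i (h.maximal i).prop.1 (h.isComplex i))
    (h.le_of_isComplex i (h'.maximal i).prop.1 (h'.isComplex i))⟩

variable [FiniteDimensional ℝ V]

lemma map {g : V ≃ₗᵢ[ℝ] V} (hg : g ∈ H.Sp) (h : H.IsSigmaDecomposition U I P) :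
    H.IsSigmaDecomposition (U.map (g.toLinearEquiv : V →ₗ[ℝ] V)) I
      (fun i => (P i).map (g.toLinearEquiv : V →ₗ[ℝ] V)) where
  mem_sphere := h.mem_sphere
  distinct := h.distinct
  ne_bot i := by
    rw [Ne, ← Submodule.finrank_eq_zero (R := ℝ), finrank_map, Submodule.finrank_eq_zero]
    exact h.ne_bot i
  maximal i := by
    refine ⟨⟨Submodule.map_mono (h.maximal i).prop.1, (h.isComplex i).map hg (h.mem_sphere i)⟩,
      fun W ⟨hWU, hW⟩ _ => ?_⟩
    -- A complex subspace of the image is pulled back by g⁻¹ and compared with the largest one in U.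
    have h1 : W.map (g⁻¹.toLinearEquiv : V →ₗ[ℝ] V) ≤ P i := by
      refine h.le_of_isComplex i ?_ (hW.map (H.Sp.inv_mem hg) (h.mem_sphere i))
      rintro _ ⟨w, hw, rfl⟩
      obtain ⟨u, hu, rfl⟩ := hWU hw
      change g.symm (g u) ∈ U
      rwa [g.symm_apply_apply]
    intro w hw
    exact ⟨g.symm w, h1 ⟨w, hw, rfl⟩, g.apply_symm_apply w⟩
  ortho i j hij := by
    have := Submodule.isOrtho_iff_inner_eq.1 (h.ortho i j hij)
    rw [Submodule.isOrtho_iff_inner_eq]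
    rintro _ ⟨x, hx, rfl⟩ _ ⟨y, hy, rfl⟩
    exact (g.inner_map_map x y).trans (this x hx y hy)
  iSup_eq := by rw [← Submodule.map_iSup, h.iSup_eq]

end IsSigmaDecomposition

variable [FiniteDimensional ℝ V] {U W : Submodule ℝ V} {𝓘 𝓘' : List (End ℝ V)}
  {Θ Θ' : List (ℕ × List ℝ)}

/-- Every `Σ`-complex subspace has invariants. -/
theorem IsSigmaComplex.exists_hasInvariants (hU : H.IsSigmaComplex U) :
    ∃ 𝓘 Θ, H.HasInvariants U 𝓘 Θ := by
  obtain ⟨-, s, I₀, P₀, h₀⟩ := hU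
  obtain ⟨I, P, h, hpos, hlt⟩ := h₀.exists_ordered
  choose m θ hθ using fun i => exists_isKahlerMultipleangle (h.mem_sphere i) (h.isComplex i)
  exact ⟨_, _, s, I, P, m, θ, h, hpos, hlt, hθ, rfl, rfl⟩

/-- The invariants of a pure subspace are unique. -/
theorem HasInvariants.unique (hU : H.IsPure U) (h : H.HasInvariants U 𝓘 Θ)
    (h' : H.HasInvariants U 𝓘' Θ') : (𝓘, Θ) = (𝓘', Θ') := by
  obtain ⟨s, I, P, m, θ, hd, hpos, hlt, hθ, rfl, rfl⟩ := h
  obtain ⟨s', I', P', m', θ', hd', hpos', hlt', hθ', rfl, rfl⟩ := h'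
  have hs : s = s' := le_antisymm (hd'.card_le hU hpos' hd hpos) (hd.card_le hU hpos hd' hpos')
  subst hs
  obtain ⟨rfl, rfl⟩ := hd.unique hU hpos hlt hd' hpos' hlt'
  have e (i) := (hθ i).unique (hd.mem_sphere i) (hθ' i)
  simp only [e]

theorem HasInvariants.map {g : V ≃ₗᵢ[ℝ] V} (hg : g ∈ H.Sp) (h : H.HasInvariants U 𝓘 Θ) :
    H.HasInvariants (U.map (g.toLinearEquiv : V →ₗ[ℝ] V)) 𝓘 Θ := by
  obtain ⟨s, I, P, m, θ, hd, hpos, hlt, hθ, rfl, rfl⟩ := h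
  exact ⟨s, I, _, m, θ, hd.map hg, hpos, hlt, fun i => (hθ i).map (hd.mem_sphere i) hg, rfl, rfl⟩

/-- Subspaces with the same invariants lie in the same orbit of `Sp(n)`. -/
theorem HasInvariants.mem_orbit (h : H.HasInvariants U 𝓘 Θ) (h' : H.HasInvariants W 𝓘 Θ) :
    W ∈ H.orbit U := by
  obtain ⟨s, I, P, m, θ, hd, -, -, hθ, rfl, rfl⟩ := h
  obtain ⟨s', I', P', m', θ', hd', -, -, hθ', hI, hΘ⟩ := h'
  have hs : s = s' := by simpa using congrArg List.length hI
  subst hs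
  have hI := List.ofFn_injective hI
  subst hI
  have hΘ := List.ofFn_injective hΘ
  have e (i) : m i = m' i ∧ θ i = θ' i := by simpa using congrFun hΘ i
  obtain ⟨g, hg, hgP⟩ := exists_mem_Sp_map_eq hd.hermitianOrtho hd'.hermitianOrtho fun i => by
    have h1 := hθ i
    rw [(e i).1, (e i).2] at h1
    exact h1.exists_mem_Sp (hd.mem_sphere i) (hθ' i)
  refine ⟨g, hg, ?_⟩
  rw [← hd.iSup_eq, ← hd'.iSup_eq, Submodule.map_iSup]
  simp only [hgP]

end Invariants
end HermitianHypercomplex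

theorem mainTheorem2 {V : Type*} [NormedAddCommGroup V] [InnerProductSpace ℝ V]
    [FiniteDimensional ℝ V] (n : ℕ) (hn : Module.finrank ℝ V = 4 * n)
    (H : HermitianHypercomplex V) :
    (∀ U : Submodule ℝ V, H.IsSigmaComplex U →
      ∃! p : List (Module.End ℝ V) × List (ℕ × List ℝ), H.HasInvariants U p.1 p.2) ∧
    (∀ U W : Submodule ℝ V, H.IsSigmaComplex U → H.IsSigmaComplex W →
      ∀ (𝓘 𝓘' : List (Module.End ℝ V)) (Θ Θ' : List (ℕ × List ℝ)),
        H.HasInvariants U 𝓘 Θ → H.HasInvariants W 𝓘' Θ' →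
          (W ∈ H.orbit U ↔ (𝓘, Θ) = (𝓘', Θ'))) := by
  constructor
  · intro U hU
    obtain ⟨𝓘, Θ, h⟩ := hU.exists_hasInvariants
    exact ⟨(𝓘, Θ), h, fun p hp => hp.unique hU.1 h⟩
  · intro U W hU hW 𝓘 𝓘' Θ Θ' h h'
    constructor
    · rintro ⟨g, hg, rfl⟩
      exact (h.map hg).unique hW.1 h'
    · intro e
      obtain ⟨rfl, rfl⟩ := Prod.mk.inj e
      exact h.mem_orbit h'
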